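/- Let $d\ge 1$ and let $f\in\mathbb{R}[x]$ be a polynomial of degree exactly $d$ and parity $d \bmod 2$, and write $\|f\|_\infty=\max_{x\in[-1,1]}|f(x)|$. For $\Phi=(\phi_0,\dots,\phi_d)\in\mathbb{R}^{d+1}$ and $x\in[-1,1]$ put $$U(x,\Phi)=e^{\mathrm{i}\phi_0 Z}\prod_{j=1}^{d}\bigl(W(x)e^{\mathrm{i}\phi_j Z}\bigr),\quad Z=\begin{pmatrix}1&0\\0&-1\end{pmatrix},\quad W(x)=\begin{pmatrix}x&\mathrm{i}\sqrt{1-x^2}\\ \mathrm{i}\sqrt{1-x^2}&x\end{pmatrix}.$$ Call $\Phi$ symmetric if $\phi_{d-j}=\phi_j$ for all $j$. Let $D_d\subset\mathbb{R}^{d+1}$ be the set of $\Phi$ with all $\phi_j\in[-\frac{\pi}{2},\frac{\pi}{2})$, except that for even $d$ the middle factor $\phi_{d/2}$ ranges over $[-\pi,\pi)$. The reduced phase factors of $\Phi$ are $\widetilde\Phi=(\phi_0,\dots,\phi_{\widetilde d-1})$ with $\widetilde d=\lceil\frac{d+1}{2}\rceil$. A pair $P\in\mathbb{C}[x]$, $Q\in\mathbb{R}[x]$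 is admissible for $f$ if $\deg P=d$, $\deg Q=d-1$; $P$ has parity $d\bmod 2$ and $Q$ has parity $(d-1)\bmod 2$; $|P(x)|^2+(1-x^2)Q(x)^2=1$ on $[-1,1]$; the leading coefficient of $Q$ is positive; and $\Re P(x)=f(x)$ for real $x$. Let $\mathfrak{F}(z)=1-f\bigl(\frac{z+z^{-1}}{2}\bigr)^2$, let $\mathcal{D}$ be the multiset of roots $r$ of $\mathfrak{F}$ with $|r|<1$ (with multiplicity), and $e(z)=z^{-d}\prod_{r\in\mathcal{D}}(z-r)$. A maximal solution for $f$ is a symmetric $\Phi^*\in D_d$ such that $$U(x,\Phi^*)=\begin{pmatrix}P(x)&\mathrm{i}Q(x)\sqrt{1-x^2}\\ \mathrm{i}Q(x)\sqrt{1-x^2}&\overline{P(x)}\end{pmatrix}\qquad(x\in[-1,1])$$ for the admissible pair $(P,Q)$ obtained from $\mathcal{D}$, i.e. the one for which there is $\alpha>0$ with $\mathfrak{F}(z)=\alpha\, e(z)e(z^{-1})$ for all $z\ne0$ and, with $z_\pm=x\pm\mathrm{i}\sqrt{1-x^2}$, $$\Im P(x)=\sqrt{\alpha}\,\frac{e(z_+)+e(z_-)}{2}\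 \ (x\in[-1,1]),\qquad Q(x)=\sqrt{\alpha}\,\frac{e(z_+)-e(z_-)}{2\mathrm{i}\sqrt{1-x^2}}\ \ (x\in(-1,1)).$$ **Theorem.** If $\|f\|_\infty\le\frac12$, then there is exactly one maximal solution $\Phi^*$ for $f$, and $$\|\widetilde\Phi^*-\widetilde\Phi^0\|_2\le\frac{\pi}{\sqrt3}\,\|f\|_\infty,\qquad \Phi^0=\Bigl(\frac{\pi}{4},0,\dots,0,\frac{\pi}{4}\Bigr)\in\mathbb{R}^{d+1}.$$ -/

import Mathlib

noncomputable section

namespace SymmetricQSP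

open Polynomial

/-- The maximum norm of a real polynomial over `[-1, 1]`. -/
def maxNorm (f : ℝ[X]) : ℝ :=
  sSup ((fun x : ℝ => |f.eval x|) '' Set.Icc (-1) 1)

/-! ### The unitary matrix generated by a set of phase factors -/

/-- `e^{i φ Z}`, with `Z` the Pauli matrix `diag(1, -1)`. -/
def expZ (φ : ℝ) : Matrix (Fin 2) (Fin 2) ℂ :=
  !![Complex.exp (Complex.I * φ), 0; 0, Complex.exp (-(Complex.I * φ))]

/-- `W(x) = e^{i arccos(x) X}`, with `X` the Pauli matrix `[[0, 1], [1, 0]]`. -/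
def W (x : ℝ) : Matrix (Fin 2) (Fin 2) ℂ :=
  !![(x : ℂ), Complex.I * (Real.sqrt (1 - x ^ 2) : ℂ);
     Complex.I * (Real.sqrt (1 - x ^ 2) : ℂ), (x : ℂ)]

/-- `U(x, Φ) = e^{i φ₀ Z} ∏_{j=1}^{d} (W(x) e^{i φⱼ Z})`, the factors ordered from left to right. -/
def U {d : ℕ} (x : ℝ) (Φ : Fin (d + 1) → ℝ) : Matrix (Fin 2) (Fin 2) ℂ :=
  expZ (Φ 0) * (List.ofFn fun j : Fin d => W x * expZ (Φ j.succ)).prod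

/-- The matrix `[[P(x), i Q(x) √(1-x²)], [i Q(x) √(1-x²), P*(x)]]` for real `x`. -/
def matrixPQ (P : ℂ[X]) (Q : ℝ[X]) (x : ℝ) : Matrix (Fin 2) (Fin 2) ℂ :=
  !![P.eval (x : ℂ), Complex.I * ((Q.eval x : ℝ) : ℂ) * (Real.sqrt (1 - x ^ 2) : ℂ);
     Complex.I * ((Q.eval x : ℝ) : ℂ) * (Real.sqrt (1 - x ^ 2) : ℂ),
       (starRingEnd ℂ) (P.eval (x : ℂ))]

/-! ### Symmetric phase factors -/

/-- `Φ = (φ₀, φ₁, …, φ₁, φ₀)`. -/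
def IsSymmetric {d : ℕ} (Φ : Fin (d + 1) → ℝ) : Prop :=
  ∀ j, Φ j.rev = Φ j

/-- The domain `D_d`: every phase factor lies in `[-π/2, π/2)`, except that the middle one
(which exists only for even `d`) lies in `[-π, π)`. -/
def phaseDomain (d : ℕ) : Set (Fin (d + 1) → ℝ) :=
  {Φ | ∀ j : Fin (d + 1),
    if 2 * (j : ℕ) = d then Φ j ∈ Set.Ico (-Real.pi) Real.pi
    else Φ j ∈ Set.Ico (-(Real.pi / 2)) (Real.pi / 2)}

/-- The number `⌈(d+1)/2⌉` of reduced phase factors. -/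
def reducedLength (d : ℕ) : ℕ := (d + 2) / 2

theorem reducedLength_eq_ceil (d : ℕ) : reducedLength d = ⌈((d : ℝ) + 1) / 2⌉₊ := by
  symm
  rw [Nat.ceil_eq_iff (by unfold reducedLength; omega)]
  have h : (d : ℝ) + 1 ≤ 2 * ((reducedLength d : ℕ) : ℝ) := by
    have : d + 1 ≤ 2 * reducedLength d := by unfold reducedLength; omega
    exact_mod_cast this
  have h' : 2 * (((reducedLength d - 1 : ℕ)) : ℝ) < (d : ℝ) + 1 := by
    have : 2 * (reducedLength d - 1) < d + 1 := by unfold reducedLength; omega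
    exact_mod_cast this
  constructor <;> linarith

theorem reducedLength_le (d : ℕ) : reducedLength d ≤ d + 1 := by
  unfold reducedLength; omega

/-- The reduced phase factors `(φ₀, …, φ_{⌈(d+1)/2⌉-1})`, as a vector with the Euclidean norm. -/
def reduced {d : ℕ} (Φ : Fin (d + 1) → ℝ) : EuclideanSpace ℝ (Fin (reducedLength d)) :=
  WithLp.toLp 2 fun j => Φ (Fin.castLE (reducedLength_le d) j)

/-- `Φ⁰ = (π/4, 0, …, 0, π/4)`. -/
def initialPhase (d : ℕ) : Fin (d + 1) → ℝ :=
  fun j => if j = 0 ∨ j = Fin.last d then Real.pi / 4 else 0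

/-! ### Admissible pairs of polynomials -/

/-- `(P, Q)` is an admissible pair of polynomials associated with the target polynomial `f`
of degree `d`. -/
structure IsAdmissiblePair (d : ℕ) (f : ℝ[X]) (P : ℂ[X]) (Q : ℝ[X]) : Prop where
  natDegree_P : P.natDegree = d
  natDegree_Q : Q.natDegree = d - 1
  parity_P : P.comp (-X) = (-1) ^ d * P
  parity_Q : Q.comp (-X) = (-1) ^ (d - 1) * Q
  normalization : ∀ x ∈ Set.Icc (-1 : ℝ) 1,
    ‖P.eval (x : ℂ)‖ ^ 2 + (1 - x ^ 2) * (Q.eval x) ^ 2 = 1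
  leadingCoeff_pos : 0 < Q.leadingCoeff
  re_P : ∀ x : ℝ, (P.eval (x : ℂ)).re = f.eval x

/-- The Laurent polynomial `𝔉(z) = 1 - f((z + z⁻¹)/2)²`, as a function on `ℂ \ {0}`. -/
def laurentF (f : ℝ[X]) (z : ℂ) : ℂ :=
  1 - ((f.map Complex.ofRealHom).eval ((z + z⁻¹) / 2)) ^ 2

/-- The polynomial `z^{2d} 𝔉(z)`. -/
def laurentNumerator (d : ℕ) (f : ℝ[X]) : ℂ[X] :=
  X ^ (2 * d) -
    (∑ k ∈ Finset.range (d + 1),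
      C (f.coeff k : ℂ) * (C (1 / 2) * (X ^ 2 + 1)) ^ k * X ^ (d - k)) ^ 2

theorem eval_laurentNumerator {d : ℕ} {f : ℝ[X]} (hf : f.natDegree ≤ d) {z : ℂ} (hz : z ≠ 0) :
    (laurentNumerator d f).eval z = z ^ (2 * d) * laurentF f z := by
  have h : (∑ k ∈ Finset.range (d + 1),
      (f.coeff k : ℂ) * ((1 / 2) * (z ^ 2 + 1)) ^ k * z ^ (d - k))
      = z ^ d * (f.map Complex.ofRealHom).eval ((z + z⁻¹) / 2) := by
    rw [eval_eq_sum_range' (n := d + 1)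
      (lt_of_le_of_lt (natDegree_map_le) (Nat.lt_succ_of_le hf)), Finset.mul_sum]
    refine Finset.sum_congr rfl fun k hk => ?_
    have hkd : k ≤ d := Nat.lt_succ_iff.mp (Finset.mem_range.mp hk)
    have e1 : (1 / 2 : ℂ) * (z ^ 2 + 1) = z * ((z + z⁻¹) / 2) := by
      field_simp
    have e2 : z ^ d = z ^ k * z ^ (d - k) := by rw [← pow_add, Nat.add_sub_cancel' hkd]
    rw [e1, e2, coeff_map, mul_pow]
    simp only [Complex.ofRealHom_eq_coe]
    ring
  simp only [laurentNumerator, eval_sub, eval_pow, eval_X, eval_finsetSum, eval_mul, eval_C,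
    eval_add, eval_one, laurentF]
  rw [h]
  ring

/-- For `deg f = d` the numerator does not vanish at `0`: its roots are exactly those of `𝔉`. -/
theorem eval_zero_laurentNumerator_ne_zero {d : ℕ} (hd : 1 ≤ d) {f : ℝ[X]}
    (hf : f.natDegree = d) : (laurentNumerator d f).eval 0 ≠ 0 := by
  have hlc : f.coeff d ≠ 0 := by
    rw [← hf]
    refine leadingCoeff_ne_zero.mpr ?_
    rintro rfl
    simp at hf
    omega
  simp only [laurentNumerator, eval_sub, eval_pow, eval_X, eval_finsetSum, eval_mul, eval_C,
    eval_add, eval_one]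
  rw [Finset.sum_eq_single d]
  · have : (0 : ℂ) ^ (2 * d) = 0 := zero_pow (by omega)
    simp [this, hlc]
  · intro k hk hkd
    have : d - k ≠ 0 := by
      have := Finset.mem_range.mp hk
      omega
    simp [zero_pow this]
  · simp

open Classical in
/-- The multiset `𝒟` of the roots of `𝔉` inside the unit disc, with multiplicity. -/
def rootsInDisc (d : ℕ) (f : ℝ[X]) : Multiset ℂ :=
  (laurentNumerator d f).roots.filter fun r => ‖r‖ < 1

/-- `e(z) = z^{-d} ∏_{r ∈ 𝒟} (z - r)`. -/
def e (d : ℕ) (f : ℝ[X]) (z : ℂ) : ℂ :=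
  z ^ (-(d : ℤ)) * ((rootsInDisc d f).map fun r => z - r).prod

/-- `(P, Q)` is the admissible pair obtained by choosing the roots of `𝔉` inside the unit disc:
with `𝔉(z) = α e(z) e(z⁻¹)` and `z = x + i √(1-x²)`,
`Im P(x) = √α (e(z) + e(z⁻¹)) / 2` and `Q(x) = √α (e(z) - e(z⁻¹)) / (2 i √(1-x²))`. -/
structure IsMaximalPair (d : ℕ) (f : ℝ[X]) (P : ℂ[X]) (Q : ℝ[X]) : Prop where
  admissible : IsAdmissiblePair d f P Q
  formula : ∃ α : ℝ, 0 < α ∧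
    (∀ z : ℂ, z ≠ 0 → laurentF f z = α * e d f z * e d f z⁻¹) ∧
    (∀ x ∈ Set.Icc (-1 : ℝ) 1,
      (((P.eval (x : ℂ)).im : ℝ) : ℂ) = (Real.sqrt α : ℂ) *
        (e d f (x + Complex.I * (Real.sqrt (1 - x ^ 2) : ℂ)) +
          e d f (x - Complex.I * (Real.sqrt (1 - x ^ 2) : ℂ))) / 2) ∧
    (∀ x ∈ Set.Ioo (-1 : ℝ) 1,
      ((Q.eval x : ℝ) : ℂ) = (Real.sqrt α : ℂ) *
        (e d f (x + Complex.I * (Real.sqrt (1 - x ^ 2) : ℂ)) -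
          e d f (x - Complex.I * (Real.sqrt (1 - x ^ 2) : ℂ))) /
        (2 * Complex.I * (Real.sqrt (1 - x ^ 2) : ℂ)))

/-- `Φ` is the maximal solution for `f`: the symmetric phase factors in `D_d` which generate the
admissible pair obtained from the roots of `𝔉` inside the unit disc. -/
def IsMaximalSolution (d : ℕ) (f : ℝ[X]) (Φ : Fin (d + 1) → ℝ) : Prop :=
  IsSymmetric Φ ∧ Φ ∈ phaseDomain d ∧
    ∃ (P : ℂ[X]) (Q : ℝ[X]), IsMaximalPair d f P Q ∧
      ∀ x ∈ Set.Icc (-1 : ℝ) 1, U x Φ = matrixPQ P Q x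

end SymmetricQSP

end

noncomputable section

namespace SymmetricQSP

open Polynomial

/-! Write `Φ = Ψ + Φ⁰`. The two outer factors `e^{iπZ/4}` multiply the diagonal of `U` by `±i`, so
the bound becomes one on the size of `Ψ`. With `z = x + i√(1-x²)`, the vectors `(1, ±1)` are
eigenvectors of `W(x)` for `z^{±1}`, and `Z` interchanges them. Hence `U(x, Ψ)(1, 1)ᵀ` is encoded by
two real polynomials in `z²` (`columnPair`, `U_mulVec_eq`). For a maximal solution they are forced:
the first is `√α R`, where `R(z²) = ∏ (z - r)`, and the second is `-F`, where `F(z²) = z^d f`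
(`IsMaximalSolution.columnPair_eq`).

The top coefficient of the first component is `∏ cos ψⱼ`, and `R` is monic, so `∏ cos ψⱼ = √α`. The
maximum principle gives `α ≥ min 𝔉 ≥ 1 - ‖f‖²` (`le_of_laurentF_eq`). Two things follow. Every `cos²
ψⱼ` exceeds `1/2`, which forces `Ψ` into the box `(-π/2, π/2)^{d+1}` (`mem_openBox_of_prod`). Also,
`1 + ψ² ≤ 1/cos² ψ` yields `∑ ψⱼ² ≤ 1/α - 1` (`sum_sq_le_of_prod`), which is at most `4/3 ‖f‖²`.

Layer stripping shows that each normalized pair with positive top coefficient comes from exactly one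
point of the box (`exists_columnPair_eq`, `columnPair_injOn`). This gives existence and uniqueness.
Symmetry of `Ψ` is a consequence: reversing the phases transposes `U`, and the target matrix is
symmetric. -/

/-! ### Layer stripping for real polynomial pairs -/

/-- The pair `(A, C)` of real polynomials such that, with `z = x + i √(1-x²)`,
`U(x, Ψ) (1, 1)ᵀ = z^{-d} (A(z²) (1, 1)ᵀ + i C(z²) (1, -1)ᵀ)`. -/
def columnPair : {d : ℕ} → (Fin (d + 1) → ℝ) → ℝ[X] × ℝ[X]
  | 0, Ψ => (C (Real.cos (Ψ 0)), C (Real.sin (Ψ 0)))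
  | _ + 1, Ψ =>
    (C (Real.cos (Ψ 0)) * (X * (columnPair (Fin.tail Ψ)).1)
        - C (Real.sin (Ψ 0)) * (columnPair (Fin.tail Ψ)).2,
      C (Real.cos (Ψ 0)) * (columnPair (Fin.tail Ψ)).2
        + C (Real.sin (Ψ 0)) * (X * (columnPair (Fin.tail Ψ)).1))

theorem natDegree_columnPair_le {d : ℕ} (Ψ : Fin (d + 1) → ℝ) :
    (columnPair Ψ).1.natDegree ≤ d ∧ (columnPair Ψ).2.natDegree ≤ d := by
  induction d with
  | zero => simp [columnPair]
  | succ d ih =>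
    obtain ⟨h1, h2⟩ := ih (Fin.tail Ψ)
    have h1' : (X * (columnPair (Fin.tail Ψ)).1).natDegree ≤ d + 1 :=
      natDegree_mul_le.trans (by rw [natDegree_X]; omega)
    have h2' : (columnPair (Fin.tail Ψ)).2.natDegree ≤ d + 1 := by omega
    exact ⟨(natDegree_sub_le_of_le ((natDegree_C_mul_le _ _).trans h1')
        ((natDegree_C_mul_le _ _).trans h2')).trans_eq (max_self _),
      natDegree_add_le_of_degree_le ((natDegree_C_mul_le _ _).trans h2')
        ((natDegree_C_mul_le _ _).trans h1')⟩

/-- Only the component multiplied by `X` reaches the new top degree, so each layer contributes one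
cosine. This single coefficient is what later controls all the phases at once. -/
theorem coeff_columnPair_fst {d : ℕ} (Ψ : Fin (d + 1) → ℝ) :
    (columnPair Ψ).1.coeff d = ∏ j, Real.cos (Ψ j) := by
  induction d with
  | zero => simp [columnPair]
  | succ d ih =>
    have h2 : (columnPair (Fin.tail Ψ)).2.coeff (d + 1) = 0 :=
      coeff_eq_zero_of_natDegree_lt (by have := (natDegree_columnPair_le (Fin.tail Ψ)).2; omega)
    rw [Fin.prod_univ_succ]
    simp only [columnPair, coeff_sub, coeff_C_mul, coeff_X_mul, h2, ih]
    simp [Fin.tail]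

/-- Together with the previous formula this makes the quotient of the top coefficients equal to `tan
(Ψ 0)` when the cosines do not vanish, so the outermost phase can be read off. -/
theorem coeff_columnPair_snd {d : ℕ} (Ψ : Fin (d + 1) → ℝ) :
    (columnPair Ψ).2.coeff d = Real.sin (Ψ 0) * ∏ j : Fin d, Real.cos (Ψ j.succ) := by
  cases d with
  | zero => simp [columnPair]
  | succ d =>
    have h2 : (columnPair (Fin.tail Ψ)).2.coeff (d + 1) = 0 :=
      coeff_eq_zero_of_natDegree_lt (by have := (natDegree_columnPair_le (Fin.tail Ψ)).2; omega)
    simp only [columnPair, coeff_add, coeff_C_mul, coeff_X_mul, h2, coeff_columnPair_fst]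
    simp [Fin.tail]

/-- The open box `(-π/2, π/2)^{d+1}`. -/
def openBox (d : ℕ) : Set (Fin (d + 1) → ℝ) :=
  {Ψ | ∀ j, Ψ j ∈ Set.Ioo (-(Real.pi / 2)) (Real.pi / 2)}

/-- In the box the cosines are positive, so the top coefficients give `tan (Ψ 0)`, and `tan` is
injective there. Undoing that rotation and cancelling `X` exposes the next layer. -/
theorem columnPair_injOn {d : ℕ} : Set.InjOn (columnPair (d := d)) (openBox d) := by
  induction d with
  | zero =>
    intro Ψ hΨ Ψ' hΨ' h
    have h2 : Real.sin (Ψ 0) = Real.sin (Ψ' 0) := by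
      have := congrArg (fun p => p.2.coeff 0) h
      simpa [columnPair] using this
    funext j
    rw [Fin.fin_one_eq_zero j]
    exact Real.injOn_sin ⟨(hΨ 0).1.le, (hΨ 0).2.le⟩ ⟨(hΨ' 0).1.le, (hΨ' 0).2.le⟩ h2
  | succ d ih =>
    intro Ψ hΨ Ψ' hΨ' h
    have hpos : ∀ Ψ ∈ openBox (d + 1), 0 < Real.cos (Ψ 0) ∧
        0 < ∏ j : Fin (d + 1), Real.cos (Ψ j.succ) := fun Ψ hΨ =>
      ⟨Real.cos_pos_of_mem_Ioo (hΨ 0),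
        Finset.prod_pos fun j _ => Real.cos_pos_of_mem_Ioo (hΨ _)⟩
    have htan : ∀ Ψ ∈ openBox (d + 1), Real.tan (Ψ 0) =
        (columnPair Ψ).2.coeff (d + 1) / (columnPair Ψ).1.coeff (d + 1) := by
      intro Ψ hΨ
      obtain ⟨h1, h2⟩ := hpos Ψ hΨ
      rw [coeff_columnPair_fst, coeff_columnPair_snd,
        Fin.prod_univ_succ (fun j => Real.cos (Ψ j)), Real.tan_eq_sin_div_cos,
        mul_div_mul_right _ _ h2.ne']
    have h0 : Ψ 0 = Ψ' 0 :=
      Real.injOn_tan (hΨ 0) (hΨ' 0) (by rw [htan Ψ hΨ, htan Ψ' hΨ', h])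
    have e1 := congrArg Prod.fst h
    have e2 := congrArg Prod.snd h
    simp only [columnPair, ← h0] at e1 e2
    have hcs : C (Real.cos (Ψ 0)) ^ 2 + C (Real.sin (Ψ 0)) ^ 2 = 1 := by
      rw [← C_pow, ← C_pow, ← C_add, Real.cos_sq_add_sin_sq, C_1]
    have e3 : X * (columnPair (Fin.tail Ψ)).1 = X * (columnPair (Fin.tail Ψ')).1 := by
      linear_combination C (Real.cos (Ψ 0)) * e1 + C (Real.sin (Ψ 0)) * e2 +
        (X * (columnPair (Fin.tail Ψ')).1 - X * (columnPair (Fin.tail Ψ)).1) * hcs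
    have e4 : (columnPair (Fin.tail Ψ)).2 = (columnPair (Fin.tail Ψ')).2 := by
      linear_combination C (Real.cos (Ψ 0)) * e2 - C (Real.sin (Ψ 0)) * e1 +
        ((columnPair (Fin.tail Ψ')).2 - (columnPair (Fin.tail Ψ)).2) * hcs
    have ht : Fin.tail Ψ = Fin.tail Ψ' :=
      ih (fun j => hΨ j.succ) (fun j => hΨ' j.succ)
        (Prod.ext (mul_left_cancel₀ X_ne_zero e3) e4)
    rw [← Fin.cons_self_tail Ψ, ← Fin.cons_self_tail Ψ', h0, ht]

/-- One layer is removed by the rotation that kills the top coefficient of `B`. The normalization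
makes the constant coefficients orthogonal to the top ones, so the same rotation kills the constant
coefficient of `A`, which can then be divided by `X`. -/
theorem exists_columnPair_eq {d : ℕ} (A B : ℝ[X]) (hA : A.natDegree ≤ d) (hB : B.natDegree ≤ d)
    (hAB : A * reflect d A + B * reflect d B = X ^ d) (hpos : 0 < A.coeff d) :
    ∃ Ψ ∈ openBox d, columnPair Ψ = (A, B) := by
  induction d generalizing A B with
  | zero =>
    obtain ⟨a, rfl⟩ := natDegree_eq_zero.mp (Nat.le_zero.mp hA)
    obtain ⟨b, rfl⟩ := natDegree_eq_zero.mp (Nat.le_zero.mp hB)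
    have hab : a * a + b * b = 1 := by
      have := congrArg (fun p => p.coeff 0) hAB
      simpa [coeff_reflect] using this
    have ha : 0 < a := by simpa using hpos
    have hb : b ∈ Set.Ioo (-1 : ℝ) 1 := by constructor <;> nlinarith
    refine ⟨fun _ => Real.arcsin b, fun _ =>
      ⟨Real.neg_pi_div_two_lt_arcsin.mpr hb.1, Real.arcsin_lt_pi_div_two.mpr hb.2⟩, ?_⟩
    have : Real.sqrt (1 - b ^ 2) = a := by
      rw [show 1 - b ^ 2 = a ^ 2 by linarith]
      exact Real.sqrt_sq ha.le
    simp [columnPair, Real.sin_arcsin hb.1.le hb.2.le, Real.cos_arcsin, this]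
  | succ d ih =>
    set t := B.coeff (d + 1) / A.coeff (d + 1) with ht
    set ψ := Real.arctan t with hψ
    have hψm : ψ ∈ Set.Ioo (-(Real.pi / 2)) (Real.pi / 2) := Real.arctan_mem_Ioo t
    have hc : 0 < Real.cos ψ := Real.cos_pos_of_mem_Ioo hψm
    have hs : Real.sin ψ * A.coeff (d + 1) = Real.cos ψ * B.coeff (d + 1) := by
      have := Real.tan_arctan t
      rw [← hψ, Real.tan_eq_sin_div_cos, ht] at this
      field_simp at this
      linarith
    -- The constant term of the normalization, whose right-hand side `X ^ (d + 1)` has none.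
    have h00 : A.coeff 0 * A.coeff (d + 1) + B.coeff 0 * B.coeff (d + 1) = 0 := by
      have := congrArg (fun p => p.coeff 0) hAB
      simpa [coeff_reflect, mul_coeff_zero, coeff_X_pow] using this
    have hcs : C (Real.cos ψ) ^ 2 + C (Real.sin ψ) ^ 2 = 1 := by
      rw [← C_pow, ← C_pow, ← C_add, Real.cos_sq_add_sin_sq, C_1]
    have hcs' : Real.cos ψ ^ 2 + Real.sin ψ ^ 2 = 1 := Real.cos_sq_add_sin_sq ψ
    set A1 := C (Real.cos ψ) * A + C (Real.sin ψ) * B with hA1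
    set B1 := C (Real.cos ψ) * B - C (Real.sin ψ) * A with hB1
    have hA1deg : A1.natDegree ≤ d + 1 :=
      natDegree_add_le_of_degree_le ((natDegree_C_mul_le _ _).trans hA)
        ((natDegree_C_mul_le _ _).trans hB)
    have hB1deg : B1.natDegree ≤ d + 1 :=
      (natDegree_sub_le_of_le ((natDegree_C_mul_le _ _).trans hB)
        ((natDegree_C_mul_le _ _).trans hA)).trans_eq (max_self _)
    have hA10 : A1.coeff 0 = 0 := by
      have h1 : Real.cos ψ * (A1.coeff 0 * A.coeff (d + 1)) = 0 := by
        simp only [hA1, coeff_add, coeff_C_mul]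
        linear_combination Real.cos ψ * Real.cos ψ * h00 + Real.cos ψ * B.coeff 0 * hs
      rcases mul_eq_zero.mp h1 with h | h
      · exact absurd h hc.ne'
      · exact (mul_eq_zero.mp h).resolve_right hpos.ne'
    have hB1d : B1.coeff (d + 1) = 0 := by
      simp only [hB1, coeff_sub, coeff_C_mul]
      linarith
    have hA1X : X * A1.divX = A1 := by
      have := X_mul_divX_add A1
      rwa [hA10, C_0, add_zero] at this
    have hA2deg : A1.divX.natDegree ≤ d := by
      rw [natDegree_divX_eq_natDegree_tsub_one]; omega
    have hB2deg : B1.natDegree ≤ d := by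
      by_contra hlt
      have heq : B1.natDegree = d + 1 := by omega
      have : B1.leadingCoeff = 0 := by rw [leadingCoeff, heq, hB1d]
      rw [leadingCoeff_eq_zero] at this
      rw [this] at heq
      simp at heq
    -- Seen in degree `d + 1`, reflection drops the factor `X` of `A1` and gives `B1` an extra one.
    -- Both products in the normalization are therefore divisible by `X`.
    have rA : reflect (d + 1) A1 = reflect d A1.divX := by
      conv_lhs => rw [← hA1X]
      rw [show d + 1 = 1 + d by ring, reflect_mul X A1.divX natDegree_X_le hA2deg]
      have : reflect 1 (X : ℝ[X]) = 1 := by simp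
      rw [this, one_mul]
    have rB : reflect (d + 1) B1 = X * reflect d B1 := by
      conv_lhs => rw [← one_mul B1]
      rw [show d + 1 = 1 + d by ring, reflect_mul 1 B1 (by simp) hB2deg]
      have : reflect 1 (1 : ℝ[X]) = X := by simp
      rw [this]
    have hnew : A1.divX * reflect d A1.divX + B1 * reflect d B1 = X ^ d := by
      apply mul_left_cancel₀ (X_ne_zero (R := ℝ))
      have h1 : A1 * reflect (d + 1) A1 + B1 * reflect (d + 1) B1 = X ^ (d + 1) := by
        rw [hA1, hB1, reflect_add, reflect_sub, reflect_C_mul, reflect_C_mul, reflect_C_mul,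
          reflect_C_mul, ← hAB]
        linear_combination (A * reflect (d + 1) A + B * reflect (d + 1) B) * hcs
      rw [rA, rB] at h1
      linear_combination h1 + reflect d A1.divX * hA1X
    have hpos' : 0 < A1.divX.coeff d := by
      rw [coeff_divX]
      have : Real.cos ψ * A1.coeff (d + 1) = A.coeff (d + 1) := by
        simp only [hA1, coeff_add, coeff_C_mul]
        linear_combination (-Real.sin ψ) * hs + A.coeff (d + 1) * hcs'
      by_contra hle
      have := mul_nonpos_of_nonneg_of_nonpos hc.le (not_lt.mp hle)
      linarith
    obtain ⟨Ψ, hΨ, hΨe⟩ := ih A1.divX B1 hA2deg hB2deg hnew hpos'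
    refine ⟨Fin.cons ψ Ψ, fun j => ?_, ?_⟩
    · refine Fin.cases ?_ (fun i => ?_) j
      · simpa using hψm
      · simpa using hΨ i
    · simp only [columnPair, Fin.tail_cons, Fin.cons_zero, hΨe, hA1X]
      refine Prod.ext ?_ ?_
      · simp only [hA1, hB1]
        linear_combination A * hcs
      · simp only [hA1, hB1]
        linear_combination B * hcs

/-! ### The product of the signal processing matrices -/

theorem U_zero (x : ℝ) (Φ : Fin 1 → ℝ) : U x Φ = expZ (Φ 0) := by simp [U]

theorem U_succ {d : ℕ} (x : ℝ) (Φ : Fin (d + 2) → ℝ) :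
    U x Φ = expZ (Φ 0) * (W x * U x (Fin.tail Φ)) := by
  simp only [U, List.ofFn_succ, List.prod_cons, Fin.tail, Matrix.mul_assoc]

/-- The point `x + i √(1-x²)` of the unit circle above `x`. -/
def circlePoint (x : ℝ) : ℂ := x + Complex.I * (Real.sqrt (1 - x ^ 2) : ℂ)

theorem conj_circlePoint (x : ℝ) : (starRingEnd ℂ) (circlePoint x) =
    x - Complex.I * (Real.sqrt (1 - x ^ 2) : ℂ) := by
  simp [circlePoint, sub_eq_add_neg]

theorem sq_add_sq_sqrt {x : ℝ} (hx : x ∈ Set.Icc (-1 : ℝ) 1) :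
    (x : ℂ) ^ 2 + (Real.sqrt (1 - x ^ 2) : ℂ) ^ 2 = 1 := by
  have : x ^ 2 + Real.sqrt (1 - x ^ 2) ^ 2 = 1 := by
    rw [Real.sq_sqrt (by nlinarith [hx.1, hx.2])]; ring
  exact_mod_cast this

theorem circlePoint_mul_conj {x : ℝ} (hx : x ∈ Set.Icc (-1 : ℝ) 1) :
    circlePoint x * (starRingEnd ℂ) (circlePoint x) = 1 := by
  rw [conj_circlePoint, circlePoint]
  linear_combination sq_add_sq_sqrt hx - (Real.sqrt (1 - x ^ 2) : ℂ) ^ 2 * Complex.I_sq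

theorem circlePoint_ne_zero {x : ℝ} (hx : x ∈ Set.Icc (-1 : ℝ) 1) : circlePoint x ≠ 0 :=
  left_ne_zero_of_mul_eq_one (circlePoint_mul_conj hx)

theorem inv_circlePoint {x : ℝ} (hx : x ∈ Set.Icc (-1 : ℝ) 1) :
    (circlePoint x)⁻¹ = (starRingEnd ℂ) (circlePoint x) :=
  inv_eq_of_mul_eq_one_right (circlePoint_mul_conj hx)

theorem norm_circlePoint {x : ℝ} (hx : x ∈ Set.Icc (-1 : ℝ) 1) : ‖circlePoint x‖ = 1 := by
  have h := circlePoint_mul_conj hx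
  rw [Complex.mul_conj, Complex.normSq_eq_norm_sq] at h
  have h' : ‖circlePoint x‖ ^ 2 = 1 := by exact_mod_cast h
  nlinarith [norm_nonneg (circlePoint x)]

theorem exp_I_mul (φ : ℝ) : Complex.exp (Complex.I * φ) =
    (Real.cos φ : ℂ) + Complex.I * (Real.sin φ : ℂ) := by
  rw [mul_comm, Complex.exp_mul_I]; push_cast; ring

theorem exp_neg_I_mul (φ : ℝ) : Complex.exp (-(Complex.I * φ)) =
    (Real.cos φ : ℂ) - Complex.I * (Real.sin φ : ℂ) := by
  rw [mul_comm, ← neg_mul, Complex.exp_mul_I, Complex.cos_neg, Complex.sin_neg]; push_cast; ring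

/-- The `SU(2)` shape: the image of `(1, 1)ᵀ` then determines the whole matrix, since its first
entry is `a + b` and its second is the conjugate of `a - b`. -/
theorem U_form {d : ℕ} (x : ℝ) (Φ : Fin (d + 1) → ℝ) :
    U x Φ 1 0 = -(starRingEnd ℂ) (U x Φ 0 1) ∧ U x Φ 1 1 = (starRingEnd ℂ) (U x Φ 0 0) := by
  induction d with
  | zero =>
    rw [U_zero]
    simp [expZ, ← Complex.exp_conj]
  | succ d ih =>
    obtain ⟨h1, h2⟩ := ih (Fin.tail Φ)
    rw [U_succ]
    constructor
    all_goals
      simp only [expZ, W, Matrix.mul_apply, Fin.sum_univ_two, h1, h2, Matrix.of_apply,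
        Matrix.cons_val_zero, Matrix.cons_val_one, Matrix.cons_val', Matrix.cons_val_fin_one]
      simp [← Complex.exp_conj]
      ring

/-- On `(1, 1)` and `(1, -1)` the matrix `z W(x)` acts by `z²` and `1`, while `cos φ + i sin φ Z`
rotates the two coordinates. This is the recursion defining `columnPair`. -/
theorem U_mulVec_eq {d : ℕ} {x : ℝ} (hx : x ∈ Set.Icc (-1 : ℝ) 1) (Φ : Fin (d + 1) → ℝ) :
    circlePoint x ^ d * (U x Φ 0 0 + U x Φ 0 1) =
      ((columnPair Φ).1.map Complex.ofRealHom).eval (circlePoint x ^ 2) +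
        Complex.I * ((columnPair Φ).2.map Complex.ofRealHom).eval (circlePoint x ^ 2) ∧
    circlePoint x ^ d * (U x Φ 1 0 + U x Φ 1 1) =
      ((columnPair Φ).1.map Complex.ofRealHom).eval (circlePoint x ^ 2) -
        Complex.I * ((columnPair Φ).2.map Complex.ofRealHom).eval (circlePoint x ^ 2) := by
  induction d with
  | zero =>
    rw [U_zero]
    simp only [expZ, columnPair, exp_I_mul, exp_neg_I_mul]
    simp
  | succ d ih =>
    obtain ⟨h1, h2⟩ := ih (Fin.tail Φ)
    have hz := circlePoint_mul_conj hx
    rw [conj_circlePoint] at hz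
    have hzd : circlePoint x = x + Complex.I * (Real.sqrt (1 - x ^ 2) : ℂ) := rfl
    rw [U_succ]
    simp only [columnPair, Polynomial.map_add, Polynomial.map_sub, Polynomial.map_mul, map_C, map_X,
      eval_add, eval_sub, eval_mul, eval_C, eval_X, expZ, W, Matrix.mul_apply, Fin.sum_univ_two,
      exp_I_mul, exp_neg_I_mul, Matrix.of_apply, Matrix.cons_val_zero, Matrix.cons_val_one,
      Matrix.cons_val', Matrix.cons_val_fin_one, Complex.ofRealHom_eq_coe, pow_succ _ d, zero_mul,
      add_zero, zero_add]
    set z := circlePoint x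
    set s : ℂ := (Real.sqrt (1 - x ^ 2) : ℂ)
    set u00 := U x (Fin.tail Φ) 0 0
    set u01 := U x (Fin.tail Φ) 0 1
    set u10 := U x (Fin.tail Φ) 1 0
    set u11 := U x (Fin.tail Φ) 1 1
    set a := ((columnPair (Fin.tail Φ)).1.map Complex.ofRealHom).eval (z ^ 2)
    set b := ((columnPair (Fin.tail Φ)).2.map Complex.ofRealHom).eval (z ^ 2)
    set c : ℂ := (Real.cos (Φ 0) : ℂ)
    set t : ℂ := (Real.sin (Φ 0) : ℂ)
    have hz2 : z * (↑x - Complex.I * s) = 1 := hz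
    have k1 : z * (↑x + Complex.I * s) = z ^ 2 := by rw [← hzd]; ring
    have g1 : z ^ d * z * (↑x * (u00 + u01) + Complex.I * s * (u10 + u11)) =
        z ^ 2 * a + Complex.I * b := by
      have : z ^ d * z * (↑x * (u00 + u01) + Complex.I * s * (u10 + u11)) =
        z * x * (z ^ d * (u00 + u01)) + z * (Complex.I * s) * (z ^ d * (u10 + u11)) := by ring
      rw [this, h1, h2]
      linear_combination a * k1 + Complex.I * b * hz2
    have g2 : z ^ d * z * (Complex.I * s * (u00 + u01) + x * (u10 + u11)) =
        z ^ 2 * a - Complex.I * b := by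
      have : z ^ d * z * (Complex.I * s * (u00 + u01) + x * (u10 + u11)) =
        z * x * (z ^ d * (u10 + u11)) + z * (Complex.I * s) * (z ^ d * (u00 + u01)) := by ring
      rw [this, h1, h2]
      linear_combination a * k1 - Complex.I * b * hz2
    constructor
    · linear_combination (c + Complex.I * t) * g1 + t * b * Complex.I_sq
    · linear_combination (c - Complex.I * t) * g2 + t * b * Complex.I_sq

theorem transpose_expZ (φ : ℝ) : (expZ φ).transpose = expZ φ := by
  ext i j; fin_cases i <;> fin_cases j <;> simp [expZ]

theorem transpose_W (x : ℝ) : (W x).transpose = W x := by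
  ext i j; fin_cases i <;> fin_cases j <;> simp [W]

theorem U_snoc {d : ℕ} (x : ℝ) (Φ : Fin (d + 2) → ℝ) :
    U x Φ = U x (Fin.init Φ) * W x * expZ (Φ (Fin.last _)) := by
  simp only [U, List.ofFn_succ_last, List.prod_append, List.prod_singleton, Fin.init,
    Matrix.mul_assoc]
  simp [Fin.succ_last]

/-- Every factor is a symmetric matrix. -/
theorem U_comp_rev {d : ℕ} (x : ℝ) (Φ : Fin (d + 1) → ℝ) :
    U x (fun j => Φ j.rev) = (U x Φ).transpose := by
  induction d with
  | zero => rw [U_zero, U_zero, transpose_expZ]; rfl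
  | succ d ih =>
    rw [U_succ, U_snoc x Φ, Matrix.transpose_mul, Matrix.transpose_mul, transpose_expZ, transpose_W,
      ← ih]
    congr 3
    funext j
    simp [Fin.tail, Fin.init, Fin.rev_succ]

/-! ### Spectral factorization of `𝔉` -/

theorem eval_map_ofReal (p : ℝ[X]) (x : ℝ) :
    (p.map Complex.ofRealHom).eval (x : ℂ) = ((p.eval x : ℝ) : ℂ) := by
  rw [eval_map, ← Complex.ofRealHom_eq_coe, eval₂_at_apply]; rfl

theorem eq_of_eval_eq_of_ne_zero {p q : ℂ[X]} (h : ∀ z : ℂ, z ≠ 0 → p.eval z = q.eval z) :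
    p = q := by
  refine eq_of_infinite_eval_eq p q (Set.Infinite.mono (fun z hz => h z hz) ?_)
  exact (Set.finite_singleton (0 : ℂ)).infinite_compl

theorem eval_reflect {p : ℂ[X]} {N : ℕ} (hp : p.natDegree ≤ N) {z : ℂ} (hz : z ≠ 0) :
    (reflect N p).eval z = z ^ N * p.eval z⁻¹ := by
  have hz' : z⁻¹ ≠ 0 := inv_ne_zero hz
  let _ : Invertible z⁻¹ := invertibleOfNonzero hz'
  have h := eval₂_reflect_mul_pow (RingHom.id ℂ) z⁻¹ N p hp
  rw [invOf_eq_inv, inv_inv, inv_pow] at h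
  change (reflect N p).eval z * (z ^ N)⁻¹ = p.eval z⁻¹ at h
  rw [← h]
  field_simp

theorem isCoprime_of_norm_roots {p q : ℂ[X]} (hp : ∀ z, p.eval z = 0 → ‖z‖ < 1)
    (hq : ∀ z, q.eval z = 0 → 1 < ‖z‖) : IsCoprime p q := by
  refine (isCoprime_iff_aeval_ne_zero_of_isAlgClosed ℂ ℂ p q).mpr fun z => ?_
  by_contra! h
  exact lt_asymm (hp z (by simpa using h.1)) (hq z (by simpa using h.2))

/-- The factor of a polynomial carrying its roots in the open unit disc is unique up to a unit. -/
theorem associated_of_mul_eq_mul {p₁ q₁ p₂ q₂ : ℂ[X]} (h : p₁ * q₁ = p₂ * q₂)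
    (hp₁ : ∀ z, p₁.eval z = 0 → ‖z‖ < 1) (hq₁ : ∀ z, q₁.eval z = 0 → 1 < ‖z‖)
    (hp₂ : ∀ z, p₂.eval z = 0 → ‖z‖ < 1) (hq₂ : ∀ z, q₂.eval z = 0 → 1 < ‖z‖) :
    Associated p₁ p₂ :=
  associated_of_dvd_dvd
    ((isCoprime_of_norm_roots hp₁ hq₂).dvd_of_dvd_mul_right (h ▸ dvd_mul_right p₁ q₁))
    ((isCoprime_of_norm_roots hp₂ hq₁).dvd_of_dvd_mul_right (h ▸ dvd_mul_right p₂ q₂))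

theorem eval_neg_of_parity {d : ℕ} {f : ℝ[X]} (hpar : f.comp (-X) = (-1) ^ d * f) (w : ℂ) :
    (f.map Complex.ofRealHom).eval (-w) = (-1) ^ d * (f.map Complex.ofRealHom).eval w := by
  have h := congrArg (fun p => (p.map Complex.ofRealHom).eval w) hpar
  simpa [Polynomial.map_comp] using h

theorem laurentF_inv (f : ℝ[X]) (z : ℂ) : laurentF f z⁻¹ = laurentF f z := by
  simp [laurentF, add_comm]

theorem laurentF_neg {d : ℕ} {f : ℝ[X]} (hpar : f.comp (-X) = (-1) ^ d * f) (z : ℂ) :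
    laurentF f (-z) = laurentF f z := by
  have : (-z + (-z)⁻¹) / 2 = -((z + z⁻¹) / 2) := by rw [inv_neg]; ring
  rw [laurentF, laurentF, this, eval_neg_of_parity hpar, mul_pow, ← pow_mul, mul_comm d 2, pow_mul]
  simp

theorem add_inv_div_two {z : ℂ} (hz : ‖z‖ = 1) : (z + z⁻¹) / 2 = (z.re : ℂ) := by
  rw [Complex.inv_eq_conj hz, Complex.add_conj]
  push_cast
  ring

theorem re_mem_Icc {z : ℂ} (hz : ‖z‖ = 1) : z.re ∈ Set.Icc (-1 : ℝ) 1 :=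
  abs_le.mp (hz ▸ Complex.abs_re_le_norm z)

theorem laurentF_of_norm_eq_one (f : ℝ[X]) {z : ℂ} (hz : ‖z‖ = 1) :
    laurentF f z = ((1 - f.eval z.re ^ 2 : ℝ) : ℂ) := by
  rw [laurentF, add_inv_div_two hz, eval_map_ofReal]
  push_cast
  rfl

theorem natDegree_laurentNumerator_le (d : ℕ) (f : ℝ[X]) :
    (laurentNumerator d f).natDegree ≤ 4 * d := by
  have hq : (C (1 / 2 : ℂ) * (X ^ 2 + 1)).natDegree ≤ 2 := by
    refine (natDegree_C_mul_le _ _).trans ?_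
    compute_degree
  refine (natDegree_sub_le_of_le (m := 4 * d) (n := 4 * d) ?_ ?_).trans_eq (max_self _)
  · rw [natDegree_X_pow]; omega
  · refine (natDegree_pow_le_of_le 2 (m := 2 * d) ?_).trans (by omega)
    refine natDegree_sum_le_of_forall_le _ _ fun k hk => ?_
    have hk' : k ≤ d := Nat.lt_succ_iff.mp (Finset.mem_range.mp hk)
    refine natDegree_mul_le.trans ?_
    rw [natDegree_X_pow]
    have := (natDegree_C_mul_le (f.coeff k : ℂ) ((C (1 / 2) * (X ^ 2 + 1)) ^ k)).trans
      (natDegree_pow_le_of_le k hq)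
    omega

theorem reflect_laurentNumerator {d : ℕ} {f : ℝ[X]} (hf : f.natDegree ≤ d) :
    reflect (4 * d) (laurentNumerator d f) = laurentNumerator d f := by
  refine eq_of_eval_eq_of_ne_zero fun z hz => ?_
  rw [eval_reflect (natDegree_laurentNumerator_le d f) hz,
    eval_laurentNumerator hf (inv_ne_zero hz), eval_laurentNumerator hf hz, laurentF_inv,
    show 4 * d = 2 * d + 2 * d by ring, pow_add, inv_pow]
  field_simp

theorem natDegree_laurentNumerator {d : ℕ} (hd : 1 ≤ d) {f : ℝ[X]} (hf : f.natDegree = d) :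
    (laurentNumerator d f).natDegree = 4 * d := by
  refine le_antisymm (natDegree_laurentNumerator_le d f) (le_natDegree_of_ne_zero ?_)
  have h := congrArg (fun p => p.coeff (4 * d)) (reflect_laurentNumerator hf.le)
  simp only [coeff_reflect, revAt_le le_rfl, Nat.sub_self] at h
  rw [← h, coeff_zero_eq_eval_zero]
  exact eval_zero_laurentNumerator_ne_zero hd hf

theorem laurentNumerator_ne_zero {d : ℕ} (hd : 1 ≤ d) {f : ℝ[X]} (hf : f.natDegree = d) :
    laurentNumerator d f ≠ 0 := by
  intro h
  exact eval_zero_laurentNumerator_ne_zero hd hf (by simp [h])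

theorem reverse_laurentNumerator {d : ℕ} (hd : 1 ≤ d) {f : ℝ[X]} (hf : f.natDegree = d) :
    (laurentNumerator d f).reverse = laurentNumerator d f := by
  rw [reverse, natDegree_laurentNumerator hd hf, reflect_laurentNumerator hf.le]

theorem map_conj_laurentNumerator (d : ℕ) (f : ℝ[X]) :
    (laurentNumerator d f).map (starRingEnd ℂ) = laurentNumerator d f := by
  simp [laurentNumerator, Polynomial.map_sum, map_ofNat]

theorem laurentNumerator_comp_neg {d : ℕ} {f : ℝ[X]} (hf : f.natDegree ≤ d)
    (hpar : f.comp (-X) = (-1) ^ d * f) :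
    (laurentNumerator d f).comp (-X) = laurentNumerator d f := by
  refine eq_of_eval_eq_of_ne_zero fun z hz => ?_
  rw [eval_comp, eval_neg, eval_X, eval_laurentNumerator hf (neg_ne_zero.mpr hz),
    eval_laurentNumerator hf hz, laurentF_neg hpar, pow_mul, neg_sq, pow_mul]

theorem eval_laurentNumerator_ne_zero {d : ℕ} {f : ℝ[X]} (hf : f.natDegree ≤ d)
    (hlt : ∀ x ∈ Set.Icc (-1 : ℝ) 1, f.eval x ^ 2 < 1) {z : ℂ} (hz : ‖z‖ = 1) :
    (laurentNumerator d f).eval z ≠ 0 := by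
  have hz0 : z ≠ 0 := by rintro rfl; simp at hz
  rw [eval_laurentNumerator hf hz0, laurentF_of_norm_eq_one f hz]
  have := hlt _ (re_mem_Icc hz)
  exact mul_ne_zero (pow_ne_zero _ hz0) (Complex.ofReal_ne_zero.mpr (by linarith))

/-- The polynomial `∏_{r ∈ 𝒟} (z - r)`. -/
def discPoly (d : ℕ) (f : ℝ[X]) : ℂ[X] := ((rootsInDisc d f).map fun r => X - C r).prod

theorem eval_multiset_prod_X_sub_C (s : Multiset ℂ) (z : ℂ) :
    ((s.map fun r => X - C r).prod).eval z = (s.map fun r => z - r).prod := by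
  rw [eval_multiset_prod, Multiset.map_map]
  simp

theorem e_eq (d : ℕ) (f : ℝ[X]) (z : ℂ) :
    e d f z = z ^ (-(d : ℤ)) * (discPoly d f).eval z := by
  rw [e, discPoly, eval_multiset_prod_X_sub_C]

theorem monic_discPoly (d : ℕ) (f : ℝ[X]) : (discPoly d f).Monic :=
  monic_multiset_prod_of_monic _ _ fun r _ => monic_X_sub_C r

theorem norm_lt_one_of_eval_discPoly {d : ℕ} {f : ℝ[X]} {z : ℂ}
    (hz : (discPoly d f).eval z = 0) : ‖z‖ < 1 := by
  rw [discPoly, eval_multiset_prod_X_sub_C, Multiset.prod_eq_zero_iff, Multiset.mem_map] at hz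
  obtain ⟨r, hr, h⟩ := hz
  rw [sub_eq_zero.mp h]
  exact (Multiset.mem_filter.mp hr).2

-- As `f² < 1` on `[-1, 1]`, there are no roots on the unit circle, so those outside the open disc
-- lie strictly outside the closed one.
open Classical in
theorem exists_discPoly_mul_eq {d : ℕ} (hd : 1 ≤ d) {f : ℝ[X]} (hf : f.natDegree = d)
    (hlt : ∀ x ∈ Set.Icc (-1 : ℝ) 1, f.eval x ^ 2 < 1) :
    ∃ q : ℂ[X], laurentNumerator d f = discPoly d f * q ∧ ∀ z, q.eval z = 0 → 1 < ‖z‖ := by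
  have hN := laurentNumerator_ne_zero hd hf
  refine ⟨C (laurentNumerator d f).leadingCoeff *
    (((laurentNumerator d f).roots.filter fun r => ¬ ‖r‖ < 1).map fun r => X - C r).prod, ?_, ?_⟩
  · conv_lhs => rw [(IsAlgClosed.splits (laurentNumerator d f)).eq_prod_roots,
      ← Multiset.filter_add_not (fun r => ‖r‖ < 1) (laurentNumerator d f).roots, Multiset.map_add,
      Multiset.prod_add]
    rw [discPoly, rootsInDisc]
    ring
  · intro z hz
    rw [eval_mul, eval_C, mul_eq_zero, eval_multiset_prod_X_sub_C, Multiset.prod_eq_zero_iff,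
      Multiset.mem_map] at hz
    obtain ⟨r, hr, h⟩ := hz.resolve_left (leadingCoeff_ne_zero.mpr hN)
    rw [sub_eq_zero.mp h]
    obtain ⟨hr1, hr2⟩ := Multiset.mem_filter.mp hr
    refine lt_of_le_of_ne (not_lt.mp hr2) fun h1 => ?_
    exact eval_laurentNumerator_ne_zero hf.le hlt h1.symm ((mem_roots'.mp hr1).2)

theorem eval_reverse {p : ℂ[X]} {z : ℂ} (hz : z ≠ 0) :
    p.reverse.eval z = z ^ p.natDegree * p.eval z⁻¹ := eval_reflect le_rfl hz

theorem norm_gt_one_of_eval_reverse {p : ℂ[X]} (hp0 : p ≠ 0) (hp : ∀ z, p.eval z = 0 → ‖z‖ < 1)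
    (z : ℂ) (hz : p.reverse.eval z = 0) : 1 < ‖z‖ := by
  have hz0 : z ≠ 0 := by
    rintro rfl
    rw [← coeff_zero_eq_eval_zero, coeff_zero_reverse] at hz
    exact hp0 (leadingCoeff_eq_zero.mp hz)
  rw [eval_reverse hz0] at hz
  have := hp _ ((mul_eq_zero.mp hz).resolve_left (pow_ne_zero _ hz0))
  rw [norm_inv] at this
  exact (inv_lt_one₀ (norm_pos_iff.mpr hz0)).mp this

theorem norm_lt_one_of_eval_reverse {p : ℂ[X]} (hp : ∀ z, p.eval z = 0 → 1 < ‖z‖)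
    (z : ℂ) (hz : p.reverse.eval z = 0) : ‖z‖ < 1 := by
  rcases eq_or_ne z 0 with rfl | hz0
  · simp
  rw [eval_reverse hz0] at hz
  have := hp _ ((mul_eq_zero.mp hz).resolve_left (pow_ne_zero _ hz0))
  rw [norm_inv] at this
  exact (one_lt_inv₀ (norm_pos_iff.mpr hz0)).mp this

/-- Transfers symmetries: a map preserving the numerator and the unit disc must preserve `discPoly`.
It is applied to complex conjugation and to `z ↦ -z`. -/
theorem discPoly_eq_of_monic {d : ℕ} (hd : 1 ≤ d) {f : ℝ[X]} (hf : f.natDegree = d)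
    (hlt : ∀ x ∈ Set.Icc (-1 : ℝ) 1, f.eval x ^ 2 < 1) {p q : ℂ[X]} (hp : p.Monic)
    (hpq : laurentNumerator d f = p * q) (hp' : ∀ z, p.eval z = 0 → ‖z‖ < 1)
    (hq' : ∀ z, q.eval z = 0 → 1 < ‖z‖) : p = discPoly d f := by
  obtain ⟨g, hg, hg'⟩ := exists_discPoly_mul_eq hd hf hlt
  exact eq_of_monic_of_associated hp (monic_discPoly d f)
    (associated_of_mul_eq_mul (hpq.symm.trans hg) hp' hq' (fun _ => norm_lt_one_of_eval_discPoly)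
      hg')

/-- The numerator is self-reciprocal, and reversal exchanges roots inside and outside the disc, so
the outer factor is the reversed inner one up to a constant. -/
theorem exists_laurentNumerator_eq {d : ℕ} (hd : 1 ≤ d) {f : ℝ[X]} (hf : f.natDegree = d)
    (hlt : ∀ x ∈ Set.Icc (-1 : ℝ) 1, f.eval x ^ 2 < 1) :
    ∃ u : ℂ, u ≠ 0 ∧ laurentNumerator d f = C u * (discPoly d f * (discPoly d f).reverse) := by
  obtain ⟨q, hq, hq'⟩ := exists_discPoly_mul_eq hd hf hlt
  have hN := laurentNumerator_ne_zero hd hf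
  have hE0 : discPoly d f ≠ 0 := (monic_discPoly d f).ne_zero
  have hE : ∀ z, (discPoly d f).eval z = 0 → ‖z‖ < 1 := fun _ => norm_lt_one_of_eval_discPoly
  have hrev : discPoly d f * q = q.reverse * (discPoly d f).reverse := by
    rw [← hq, mul_comm, ← reverse_mul_of_domain, ← hq, reverse_laurentNumerator hd hf]
  have hass := associated_of_mul_eq_mul hrev hE hq' (norm_lt_one_of_eval_reverse hq')
    (norm_gt_one_of_eval_reverse hE0 hE)
  obtain ⟨v, hv⟩ := hass
  obtain ⟨u, hu, huv⟩ := isUnit_iff.mp v.isUnit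
  refine ⟨u, hu.ne_zero, ?_⟩
  rw [hq, hrev, ← hv, ← huv]
  ring

theorem natDegree_discPoly {d : ℕ} (hd : 1 ≤ d) {f : ℝ[X]} (hf : f.natDegree = d)
    (hlt : ∀ x ∈ Set.Icc (-1 : ℝ) 1, f.eval x ^ 2 < 1) : (discPoly d f).natDegree = 2 * d := by
  obtain ⟨u, hu, h⟩ := exists_laurentNumerator_eq hd hf hlt
  have hE0 : discPoly d f ≠ 0 := (monic_discPoly d f).ne_zero
  have h0 : (discPoly d f).coeff 0 ≠ 0 := by
    intro h0
    apply eval_zero_laurentNumerator_ne_zero hd hf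
    rw [h, eval_mul, eval_mul, ← coeff_zero_eq_eval_zero (discPoly d f), h0]
    simp
  have hr : (discPoly d f).reverse.natDegree = (discPoly d f).natDegree := by
    rw [reverse_natDegree, natTrailingDegree_eq_zero.mpr (Or.inr h0), Nat.sub_zero]
  have := congrArg natDegree h
  rw [natDegree_laurentNumerator hd hf, natDegree_C_mul hu, natDegree_mul hE0
    (by rwa [Ne, reverse_eq_zero]), hr] at this
  omega

theorem map_conj_discPoly {d : ℕ} (hd : 1 ≤ d) {f : ℝ[X]} (hf : f.natDegree = d)
    (hlt : ∀ x ∈ Set.Icc (-1 : ℝ) 1, f.eval x ^ 2 < 1) :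
    (discPoly d f).map (starRingEnd ℂ) = discPoly d f := by
  obtain ⟨q, hq, hq'⟩ := exists_discPoly_mul_eq hd hf hlt
  have key : ∀ (p : ℂ[X]) (z : ℂ), (p.map (starRingEnd ℂ)).eval z = 0 →
      p.eval ((starRingEnd ℂ) z) = 0 := by
    intro p z hz
    have h1 : (p.map (starRingEnd ℂ)).eval ((starRingEnd ℂ) ((starRingEnd ℂ) z)) = 0 := by
      rwa [Complex.conj_conj]
    rw [eval_map, eval₂_at_apply] at h1
    exact (map_eq_zero _).mp h1
  refine discPoly_eq_of_monic hd hf hlt ((monic_discPoly d f).map _)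
    (q := q.map (starRingEnd ℂ)) ?_ ?_ ?_
  · rw [← Polynomial.map_mul, ← hq, map_conj_laurentNumerator]
  · intro z hz
    simpa using norm_lt_one_of_eval_discPoly (key _ z hz)
  · intro z hz
    simpa using hq' _ (key _ z hz)

theorem discPoly_comp_neg {d : ℕ} (hd : 1 ≤ d) {f : ℝ[X]} (hf : f.natDegree = d)
    (hpar : f.comp (-X) = (-1) ^ d * f) (hlt : ∀ x ∈ Set.Icc (-1 : ℝ) 1, f.eval x ^ 2 < 1) :
    (discPoly d f).comp (-X) = discPoly d f := by
  obtain ⟨q, hq, hq'⟩ := exists_discPoly_mul_eq hd hf hlt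
  refine discPoly_eq_of_monic hd hf hlt (q := q.comp (-X)) ?_ ?_ ?_ ?_
  · have := (monic_discPoly d f).neg_one_pow_natDegree_mul_comp_neg_X
    rwa [natDegree_discPoly hd hf hlt, pow_mul, neg_one_sq, one_pow, one_mul] at this
  · rw [← mul_comp, ← hq, laurentNumerator_comp_neg hf.le hpar]
  · intro z hz
    rw [eval_comp, eval_neg, eval_X] at hz
    simpa using norm_lt_one_of_eval_discPoly hz
  · intro z hz
    rw [eval_comp, eval_neg, eval_X] at hz
    simpa using hq' _ hz

theorem exists_map_ofReal_eq {p : ℂ[X]} (hp : p.map (starRingEnd ℂ) = p) :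
    ∃ q : ℝ[X], q.map Complex.ofRealHom = p := by
  have : p ∈ lifts Complex.ofRealHom := by
    rw [lifts_iff_coeff_lifts]
    intro n
    have h := congrArg (fun q => q.coeff n) hp
    simp only [coeff_map] at h
    obtain ⟨r, hr⟩ := Complex.conj_eq_iff_real.mp h
    exact ⟨r, hr.symm⟩
  exact (mem_lifts p).mp this

theorem exists_expand_eq {p : ℝ[X]} (hp : p.comp (-X) = p) : ∃ q : ℝ[X], expand ℝ 2 q = p := by
  refine ⟨contract 2 p, ?_⟩
  ext n
  rw [coeff_expand two_pos]
  split_ifs with h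
  · rw [coeff_contract two_ne_zero, Nat.div_mul_cancel h]
  · have h1 := congrArg (fun q => q.coeff n) hp
    have h2 : (-X : ℝ[X]) = C (-1) * X := by simp
    simp only [h2, comp_C_mul_X_coeff] at h1
    rw [Odd.neg_one_pow (Nat.odd_iff.mpr (by omega))] at h1
    linarith

/-- There is a monic real polynomial `R` of degree `d` with `∏_{r ∈ 𝒟} (z - r) = R(z²)`. -/
theorem exists_real_discPoly {d : ℕ} (hd : 1 ≤ d) {f : ℝ[X]} (hf : f.natDegree = d)
    (hpar : f.comp (-X) = (-1) ^ d * f) (hlt : ∀ x ∈ Set.Icc (-1 : ℝ) 1, f.eval x ^ 2 < 1) :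
    ∃ R : ℝ[X], (expand ℝ 2 R).map Complex.ofRealHom = discPoly d f ∧ R.natDegree = d ∧
      R.Monic := by
  obtain ⟨q, hq⟩ := exists_map_ofReal_eq (map_conj_discPoly hd hf hlt)
  have hqn : q.comp (-X) = q := by
    apply map_injective Complex.ofRealHom Complex.ofRealHom.injective
    rw [Polynomial.map_comp, hq, Polynomial.map_neg, map_X, discPoly_comp_neg hd hf hpar hlt]
  obtain ⟨R, rfl⟩ := exists_expand_eq hqn
  refine ⟨R, hq, ?_, ?_⟩
  · have h1 := natDegree_discPoly hd hf hlt
    rw [← hq, natDegree_map, natDegree_expand] at h1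
    omega
  · have h1 := monic_discPoly d f
    rw [← hq, monic_map_iff] at h1
    exact (monic_expand_iff two_pos).mp h1

theorem e_mul_e_inv (d : ℕ) (f : ℝ[X]) {z : ℂ} (hz : z ≠ 0) :
    e d f z * e d f z⁻¹ = (discPoly d f).eval z * (discPoly d f).eval z⁻¹ := by
  rw [e_eq, e_eq, inv_zpow]
  field_simp

theorem conj_e {d : ℕ} (hd : 1 ≤ d) {f : ℝ[X]} (hf : f.natDegree = d)
    (hlt : ∀ x ∈ Set.Icc (-1 : ℝ) 1, f.eval x ^ 2 < 1) (z : ℂ) :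
    (starRingEnd ℂ) (e d f z) = e d f ((starRingEnd ℂ) z) := by
  rw [e_eq, e_eq, map_mul, map_zpow₀]
  congr 1
  conv_rhs => rw [← map_conj_discPoly hd hf hlt]
  rw [eval_map, eval₂_at_apply]

theorem e_mul_e_inv_of_norm_eq_one {d : ℕ} (hd : 1 ≤ d) {f : ℝ[X]} (hf : f.natDegree = d)
    (hlt : ∀ x ∈ Set.Icc (-1 : ℝ) 1, f.eval x ^ 2 < 1) {z : ℂ} (hz : ‖z‖ = 1) :
    e d f z * e d f z⁻¹ = ((‖(discPoly d f).eval z‖ ^ 2 : ℝ) : ℂ) := by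
  rw [Complex.inv_eq_conj hz, ← conj_e hd hf hlt, Complex.mul_conj, Complex.normSq_eq_norm_sq, e_eq]
  simp [hz]

theorem discPoly_eval_ne_zero {d : ℕ} {f : ℝ[X]} {z : ℂ} (hz : ‖z‖ = 1) :
    (discPoly d f).eval z ≠ 0 := fun h => (norm_lt_one_of_eval_discPoly h).ne hz

/-- The constant is real and positive because at `z = 1` both `𝔉` and `e(z)e(z⁻¹)` are. -/
theorem exists_laurentF_eq {d : ℕ} (hd : 1 ≤ d) {f : ℝ[X]} (hf : f.natDegree = d)
    (hlt : ∀ x ∈ Set.Icc (-1 : ℝ) 1, f.eval x ^ 2 < 1) :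
    ∃ α : ℝ, 0 < α ∧ ∀ z : ℂ, z ≠ 0 → laurentF f z = α * e d f z * e d f z⁻¹ := by
  obtain ⟨u, hu, h⟩ := exists_laurentNumerator_eq hd hf hlt
  have key : ∀ z : ℂ, z ≠ 0 → laurentF f z = u * (e d f z * e d f z⁻¹) := by
    intro z hz
    have h1 := eval_laurentNumerator hf.le hz
    rw [h, eval_mul, eval_C, eval_mul, eval_reverse hz, natDegree_discPoly hd hf hlt] at h1
    rw [e_mul_e_inv d f hz]
    refine mul_left_cancel₀ (pow_ne_zero (2 * d) hz) (h1.symm.trans ?_)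
    ring
  have h1 := key 1 one_ne_zero
  rw [e_mul_e_inv_of_norm_eq_one hd hf hlt norm_one, laurentF_of_norm_eq_one f norm_one] at h1
  have hpos : 0 < ‖(discPoly d f).eval 1‖ ^ 2 :=
    pow_pos (norm_pos_iff.mpr (discPoly_eval_ne_zero norm_one)) 2
  have hlt1 := hlt _ (re_mem_Icc (z := 1) norm_one)
  refine ⟨(1 - f.eval (1 : ℂ).re ^ 2) / ‖(discPoly d f).eval 1‖ ^ 2,
    div_pos (by linarith) hpos, fun z hz => ?_⟩
  rw [key z hz, mul_assoc]
  congr 1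
  rw [Complex.ofReal_div, h1, mul_div_cancel_right₀]
  exact_mod_cast hpos.ne'

/-- The constant of the spectral factorization is at least the minimum of `𝔉` on the circle. -/
theorem le_of_laurentF_eq {d : ℕ} (hd : 1 ≤ d) {f : ℝ[X]} (hf : f.natDegree = d) {m α : ℝ}
    (hm : 0 < m) (hle : ∀ x ∈ Set.Icc (-1 : ℝ) 1, m ≤ 1 - f.eval x ^ 2) (hα : 0 < α)
    (h : ∀ z : ℂ, z ≠ 0 → laurentF f z = α * e d f z * e d f z⁻¹) : m ≤ α := by
  have hlt : ∀ x ∈ Set.Icc (-1 : ℝ) 1, f.eval x ^ 2 < 1 := fun x hx => by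
    linarith [hle x hx]
  have hE0 : discPoly d f ≠ 0 := (monic_discPoly d f).ne_zero
  have hne : ∀ z : ℂ, ‖z‖ ≤ 1 → (discPoly d f).reverse.eval z ≠ 0 := fun z hz h0 =>
    (norm_gt_one_of_eval_reverse hE0 (fun _ => norm_lt_one_of_eval_discPoly) z h0).not_ge hz
  have hcirc : ∀ z : ℂ, ‖z‖ = 1 → m ≤ α * ‖(discPoly d f).reverse.eval z‖ ^ 2 := by
    intro z hz
    have hz0 : z ≠ 0 := by rintro rfl; simp at hz
    have hz' : ‖z⁻¹‖ = 1 := by rw [norm_inv, hz, inv_one]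
    have h1 := h z⁻¹ (inv_ne_zero hz0)
    rw [mul_assoc, e_mul_e_inv_of_norm_eq_one hd hf hlt hz', laurentF_of_norm_eq_one f hz'] at h1
    rw [eval_reverse hz0, norm_mul, norm_pow, hz, one_pow, one_mul]
    have h2 : 1 - f.eval z⁻¹.re ^ 2 = α * ‖(discPoly d f).eval z⁻¹‖ ^ 2 := by exact_mod_cast h1
    rw [← h2]
    exact hle _ (re_mem_Icc hz')
  -- Maximum principle for the inverse of the reversed polynomial, which has no zeros in the closed
  -- disc. Its value at `0` is `1` because `discPoly` is monic, and on the circle it is at most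
  -- `√(α/m)`.
  have hmax := Complex.norm_le_of_forall_mem_frontier_norm_le (E := ℂ)
    (f := fun z => ((discPoly d f).reverse.eval z)⁻¹) (U := Metric.ball 0 1)
    (C := Real.sqrt (α / m)) (z := 0) Metric.isBounded_ball ?_ ?_ (subset_closure (Metric.mem_ball_self one_pos))
  · simp only [← coeff_zero_eq_eval_zero, coeff_zero_reverse, (monic_discPoly d f).leadingCoeff,
      inv_one, norm_one] at hmax
    rw [Real.one_le_sqrt, one_le_div hm] at hmax
    exact hmax
  · refine DifferentiableOn.diffContOnCl fun z hz => ?_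
    rw [closure_ball 0 one_ne_zero] at hz
    exact ((Polynomial.differentiable _ z).inv (hne z (by simpa using hz))).differentiableWithinAt
  · intro z hz
    rw [frontier_ball 0 one_ne_zero, mem_sphere_zero_iff_norm] at hz
    have h1 := hcirc z hz
    have h2 : 0 < ‖(discPoly d f).reverse.eval z‖ := norm_pos_iff.mpr (hne z hz.le)
    rw [norm_inv]
    apply Real.le_sqrt_of_sq_le
    rw [inv_pow, inv_le_comm₀ (pow_pos h2 2) (div_pos hα hm), inv_div, div_le_iff₀ hα]
    linarith

theorem eval_map_eq_discPoly {d : ℕ} {f R : ℝ[X]}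
    (hR : (expand ℝ 2 R).map Complex.ofRealHom = discPoly d f) (z : ℂ) :
    (R.map Complex.ofRealHom).eval (z ^ 2) = (discPoly d f).eval z := by
  rw [← hR, map_expand, expand_eval]

/-- For a polynomial `f` of parity `d`, `z^d f((z + z⁻¹)/2)` is a polynomial in `z²`. -/
theorem exists_halved_laurent {d : ℕ} {f : ℝ[X]} (hf : f.natDegree ≤ d)
    (hpar : f.comp (-X) = (-1) ^ d * f) :
    ∃ F : ℝ[X], F.natDegree ≤ d ∧ ∀ z : ℂ, z ≠ 0 → (F.map Complex.ofRealHom).eval (z ^ 2) =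
      z ^ d * (f.map Complex.ofRealHom).eval ((z + z⁻¹) / 2) := by
  set S : ℝ[X] := ∑ k ∈ Finset.range (d + 1),
    C (f.coeff k) * (C (1 / 2) * (X ^ 2 + 1)) ^ k * X ^ (d - k) with hS
  have hSdeg : S.natDegree ≤ 2 * d := by
    have hq : (C (1 / 2 : ℝ) * (X ^ 2 + 1)).natDegree ≤ 2 := by
      refine (natDegree_C_mul_le _ _).trans ?_
      compute_degree
    refine natDegree_sum_le_of_forall_le _ _ fun k hk => ?_
    have hk' : k ≤ d := Nat.lt_succ_iff.mp (Finset.mem_range.mp hk)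
    refine natDegree_mul_le.trans ?_
    rw [natDegree_X_pow]
    have := (natDegree_C_mul_le (f.coeff k) ((C (1 / 2) * (X ^ 2 + 1)) ^ k)).trans
      (natDegree_pow_le_of_le k hq)
    omega
  have hSeval : ∀ z : ℂ, z ≠ 0 → (S.map Complex.ofRealHom).eval z =
      z ^ d * (f.map Complex.ofRealHom).eval ((z + z⁻¹) / 2) := by
    intro z hz
    rw [eval_eq_sum_range' (n := d + 1)
      (lt_of_le_of_lt natDegree_map_le (Nat.lt_succ_of_le hf)), Finset.mul_sum, hS,
      Polynomial.map_sum, eval_finsetSum]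
    refine Finset.sum_congr rfl fun k hk => ?_
    have hkd : k ≤ d := Nat.lt_succ_iff.mp (Finset.mem_range.mp hk)
    have e1 : (1 / 2 : ℂ) * (z ^ 2 + 1) = z * ((z + z⁻¹) / 2) := by field_simp
    have e2 : z ^ d = z ^ k * z ^ (d - k) := by rw [← pow_add, Nat.add_sub_cancel' hkd]
    have e3 : ((C (f.coeff k) * (C (1 / 2) * (X ^ 2 + 1)) ^ k * X ^ (d - k)).map
        Complex.ofRealHom).eval z =
        (f.coeff k : ℂ) * ((1 / 2) * (z ^ 2 + 1)) ^ k * z ^ (d - k) := by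
      simp
    rw [e3, e1, e2, coeff_map, mul_pow, Complex.ofRealHom_eq_coe]
    ring
  have hSeven : S.comp (-X) = S := by
    apply map_injective Complex.ofRealHom Complex.ofRealHom.injective
    refine eq_of_eval_eq_of_ne_zero fun z hz => ?_
    rw [Polynomial.map_comp, Polynomial.map_neg, map_X, eval_comp, eval_neg, eval_X,
      hSeval _ (neg_ne_zero.mpr hz), hSeval _ hz,
      show (-z + (-z)⁻¹) / 2 = -((z + z⁻¹) / 2) by rw [inv_neg]; ring, eval_neg_of_parity hpar,
      ← mul_assoc, ← mul_pow]
    simp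
  obtain ⟨F, hF⟩ := exists_expand_eq hSeven
  refine ⟨F, ?_, fun z hz => ?_⟩
  · rw [← hF, natDegree_expand] at hSdeg
    omega
  · rw [← hSeval z hz, ← hF, map_expand, expand_eval]

/-- This is `f² + α e(z)e(z⁻¹) = 1` written in the variable `w = z²`: the normalization needed for
layer stripping. -/
theorem mul_reflect_add_mul_reflect {d : ℕ} {f R F : ℝ[X]} {α : ℝ} (hα : 0 < α)
    (h : ∀ z : ℂ, z ≠ 0 → laurentF f z = α * e d f z * e d f z⁻¹)
    (hR : (expand ℝ 2 R).map Complex.ofRealHom = discPoly d f) (hRd : R.natDegree ≤ d)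
    (hFd : F.natDegree ≤ d) (hF : ∀ z : ℂ, z ≠ 0 → (F.map Complex.ofRealHom).eval (z ^ 2) =
      z ^ d * (f.map Complex.ofRealHom).eval ((z + z⁻¹) / 2)) :
    (C (Real.sqrt α) * R) * reflect d (C (Real.sqrt α) * R) + (-F) * reflect d (-F) = X ^ d := by
  have hα' : (Real.sqrt α : ℂ) * (Real.sqrt α : ℂ) = α := by
    exact_mod_cast Real.mul_self_sqrt hα.le
  apply map_injective Complex.ofRealHom Complex.ofRealHom.injective
  refine eq_of_eval_eq_of_ne_zero fun w hw => ?_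
  obtain ⟨z, rfl⟩ := IsAlgClosed.exists_pow_nat_eq w two_pos
  have hz : z ≠ 0 := by rintro rfl; simp at hw
  rw [reflect_C_mul, reflect_neg]
  simp only [Polynomial.map_add, Polynomial.map_mul, Polynomial.map_neg, map_C, ← reflect_map,
    Polynomial.map_pow, map_X, eval_add, eval_mul, eval_neg, eval_C, eval_pow, eval_X]
  rw [eval_reflect (natDegree_map_le.trans hRd) hw, eval_reflect (natDegree_map_le.trans hFd) hw,
    ← inv_pow, eval_map_eq_discPoly hR, eval_map_eq_discPoly hR, hF z hz, hF _ (inv_ne_zero hz),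
    inv_inv, add_comm z⁻¹ z]
  have h1 := h z hz
  rw [mul_assoc, e_mul_e_inv d f hz, laurentF] at h1
  have hzi : z ^ d * z⁻¹ ^ d = 1 := by rw [← mul_pow, mul_inv_cancel₀ hz, one_pow]
  simp only [Complex.ofRealHom_eq_coe]
  set a := (discPoly d f).eval z
  set b := (discPoly d f).eval z⁻¹
  set g := (f.map Complex.ofRealHom).eval ((z + z⁻¹) / 2)
  linear_combination (z ^ 2) ^ d * a * b * hα' - (z ^ 2) ^ d * h1 + (z ^ 2) ^ d * g ^ 2 * hzi

/-! ### Shifting the phase factors by `Φ⁰` -/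

theorem expZ_add (a b : ℝ) : expZ (a + b) = expZ a * expZ b := by
  ext i j
  fin_cases i <;> fin_cases j <;> simp [expZ, ← Complex.exp_add] <;> ring_nf

theorem U_add_first {d : ℕ} (x a : ℝ) {Φ Φ' : Fin (d + 1) → ℝ} (h0 : Φ' 0 = a + Φ 0)
    (hs : ∀ j : Fin d, Φ' j.succ = Φ j.succ) : U x Φ' = expZ a * U x Φ := by
  simp only [U, h0, hs, expZ_add, Matrix.mul_assoc]

theorem U_add_last {d : ℕ} (x a : ℝ) {Φ Φ' : Fin (d + 1) → ℝ}
    (h0 : Φ' (Fin.last d) = a + Φ (Fin.last d))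
    (hs : ∀ j : Fin d, Φ' j.castSucc = Φ j.castSucc) : U x Φ' = U x Φ * expZ a := by
  have h := U_add_first x a (Φ := fun j => Φ j.rev) (Φ' := fun j => Φ' j.rev) (by simpa using h0)
    (fun j => by simpa [Fin.rev_succ] using hs j.rev)
  rw [U_comp_rev, U_comp_rev] at h
  rw [← Matrix.transpose_transpose (U x Φ'), h, Matrix.transpose_mul, transpose_expZ,
    Matrix.transpose_transpose]

theorem U_add_initialPhase {d : ℕ} (hd : 1 ≤ d) (x : ℝ) (Ψ : Fin (d + 1) → ℝ) :
    U x (Ψ + initialPhase d) = expZ (Real.pi / 4) * U x Ψ * expZ (Real.pi / 4) := by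
  have hl : Fin.last d ≠ 0 := by
    intro h
    have := congrArg Fin.val h
    simp at this
    omega
  set Ψ' : Fin (d + 1) → ℝ := fun j => if j = 0 then Real.pi / 4 + Ψ j else Ψ j with hΨ'
  have h1 : U x Ψ' = expZ (Real.pi / 4) * U x Ψ :=
    U_add_first x _ (by simp [hΨ']) (fun j => by simp [hΨ', Fin.succ_ne_zero])
  rw [← h1]
  refine U_add_last x _ (by simp [hΨ', initialPhase, hl, add_comm]) fun j => ?_
  by_cases hj : j.castSucc = 0
  · simp [hΨ', initialPhase, hj, add_comm]
  · simp [hΨ', initialPhase, hj, (Fin.castSucc_lt_last j).ne]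

theorem exp_pi_div_four_mul_self :
    Complex.exp (Complex.I * ((Real.pi / 4 : ℝ) : ℂ)) *
      Complex.exp (Complex.I * ((Real.pi / 4 : ℝ) : ℂ)) = Complex.I := by
  rw [← Complex.exp_add]
  push_cast
  rw [show Complex.I * ((Real.pi : ℂ) / 4) + Complex.I * ((Real.pi : ℂ) / 4) =
    Real.pi / 2 * Complex.I by ring]
  exact Complex.exp_pi_div_two_mul_I

/-- The two phases `e^{±iπ/4}` multiply to `±i` on the diagonal and cancel off it. The condition `Re
P = f` thus becomes a condition on the imaginary part of the upper-left entry. -/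
theorem U_add_initialPhase_eq {d : ℕ} (hd : 1 ≤ d) (x : ℝ) (Ψ : Fin (d + 1) → ℝ) :
    U x (Ψ + initialPhase d) = !![Complex.I * U x Ψ 0 0, U x Ψ 0 1;
      U x Ψ 1 0, -Complex.I * U x Ψ 1 1] := by
  rw [U_add_initialPhase hd]
  set w := Complex.exp (Complex.I * ((Real.pi / 4 : ℝ) : ℂ)) with hw
  have h1 : w * w = Complex.I := exp_pi_div_four_mul_self
  have h2 : Complex.exp (-(Complex.I * ((Real.pi / 4 : ℝ) : ℂ))) = w⁻¹ := Complex.exp_neg _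
  have h0 : w ≠ 0 := Complex.exp_ne_zero _
  have h3 : w⁻¹ * w⁻¹ = -Complex.I := by rw [← mul_inv, h1, Complex.inv_I]
  have hz : expZ (Real.pi / 4) = !![w, 0; 0, w⁻¹] := by rw [expZ, h2]
  rw [hz]
  ext i j
  fin_cases i <;> fin_cases j <;>
    simp only [Matrix.mul_apply, Fin.sum_univ_two, Fin.zero_eta, Fin.mk_one, Matrix.of_apply,
      Matrix.cons_val_zero, Matrix.cons_val_one, Matrix.cons_val', Matrix.cons_val_fin_one]
  · linear_combination U x Ψ 0 0 * h1
  · linear_combination U x Ψ 0 1 * mul_inv_cancel₀ h0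
  · linear_combination U x Ψ 1 0 * mul_inv_cancel₀ h0
  · linear_combination U x Ψ 1 1 * h3

theorem eq_of_eval_circlePoint_sq {p q : ℂ[X]} (h : ∀ x ∈ Set.Ioo (-1 : ℝ) 1,
    p.eval (circlePoint x ^ 2) = q.eval (circlePoint x ^ 2)) : p = q := by
  -- Half of the interval suffices: there `Re z² = 2x² - 1` is injective in `x`.
  have hinf : ((fun x => circlePoint x ^ 2) '' Set.Ioo (0 : ℝ) 1).Infinite := by
    refine (Set.Ioo_infinite zero_lt_one).image fun x hx y hy hxy => ?_
    have key : ∀ x ∈ Set.Ioo (0 : ℝ) 1, (circlePoint x ^ 2).re = 2 * x ^ 2 - 1 := by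
      intro x hx
      have : Real.sqrt (1 - x ^ 2) ^ 2 = 1 - x ^ 2 :=
        Real.sq_sqrt (by nlinarith [hx.1, hx.2])
      simp [circlePoint, pow_two, Complex.mul_re] at this ⊢
      linarith
    have h1 := congrArg Complex.re hxy
    simp only [key x hx, key y hy] at h1
    nlinarith [hx.1, hy.1]
  refine eq_of_infinite_eval_eq p q (hinf.mono ?_)
  rintro _ ⟨x, hx, rfl⟩
  exact h x ⟨by linarith [hx.1], hx.2⟩

theorem eq_of_eval_Ioo {p q : ℝ[X]} (h : ∀ x ∈ Set.Ioo (-1 : ℝ) 1, p.eval x = q.eval x) : p = q :=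
  eq_of_infinite_eval_eq p q ((Set.Ioo_infinite (by norm_num)).mono h)

/-- Phase factors in the open box are determined by the matrices which they generate. -/
theorem eq_of_U_eq {d : ℕ} {Ψ Ψ' : Fin (d + 1) → ℝ} (hΨ : Ψ ∈ openBox d) (hΨ' : Ψ' ∈ openBox d)
    (h : ∀ x ∈ Set.Icc (-1 : ℝ) 1, U x Ψ = U x Ψ') : Ψ = Ψ' := by
  have hinj := map_injective Complex.ofRealHom Complex.ofRealHom.injective
  refine columnPair_injOn hΨ hΨ' (Prod.ext (hinj ?_) (hinj ?_)) <;>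
    refine eq_of_eval_circlePoint_sq fun x hx => ?_ <;>
    obtain ⟨h1, h2⟩ := U_mulVec_eq (Set.Ioo_subset_Icc_self hx) Ψ <;>
    obtain ⟨h3, h4⟩ := U_mulVec_eq (Set.Ioo_subset_Icc_self hx) Ψ' <;>
    rw [h x (Set.Ioo_subset_Icc_self hx)] at h1 h2
  · linear_combination (h3 + h4 - h1 - h2) / 2
  · refine mul_left_cancel₀ Complex.I_ne_zero ?_
    linear_combination (h3 - h4 - h1 + h2) / 2

theorem discPoly_eval_eq {d : ℕ} (f : ℝ[X]) {z : ℂ} (hz : z ≠ 0) :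
    (discPoly d f).eval z = z ^ d * e d f z := by
  rw [e_eq, zpow_neg, zpow_natCast, mul_inv_cancel_left₀ (pow_ne_zero d hz)]

/-- The formulas for `Im P` and `Q` add up to `Im P + iQ√(1-x²) = √α e(z)`, and `z^d e(z)` is
`discPoly`. So only `α` could still distinguish two maximal solutions. -/
theorem IsMaximalSolution.columnPair_eq {d : ℕ} (hd : 1 ≤ d) {f R F : ℝ[X]}
    (hR : (expand ℝ 2 R).map Complex.ofRealHom = discPoly d f)
    (hF : ∀ z : ℂ, z ≠ 0 → (F.map Complex.ofRealHom).eval (z ^ 2) =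
      z ^ d * (f.map Complex.ofRealHom).eval ((z + z⁻¹) / 2))
    {Ψ : Fin (d + 1) → ℝ} (h : IsMaximalSolution d f (Ψ + initialPhase d)) :
    ∃ α : ℝ, 0 < α ∧ (∀ z : ℂ, z ≠ 0 → laurentF f z = α * e d f z * e d f z⁻¹) ∧
      columnPair Ψ = (C (Real.sqrt α) * R, -F) := by
  obtain ⟨-, -, P, Q, ⟨hadm, α, hα, hfac, hP, hQ⟩, hU⟩ := h
  refine ⟨α, hα, hfac, ?_⟩
  have key : ∀ x ∈ Set.Ioo (-1 : ℝ) 1,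
      ((columnPair Ψ).1.map Complex.ofRealHom).eval (circlePoint x ^ 2) =
        Real.sqrt α * (discPoly d f).eval (circlePoint x) ∧
      ((columnPair Ψ).2.map Complex.ofRealHom).eval (circlePoint x ^ 2) =
        -(circlePoint x ^ d * f.eval x) := by
    intro x hx
    have hx' := Set.Ioo_subset_Icc_self hx
    have hz := circlePoint_ne_zero hx'
    have h1 := hU x hx'
    rw [U_add_initialPhase_eq hd, matrixPQ] at h1
    have e00 : Complex.I * U x Ψ 0 0 = P.eval (x : ℂ) := congrFun (congrFun h1 0) 0
    have e01 : U x Ψ 0 1 = Complex.I * ((Q.eval x : ℝ) : ℂ) * (Real.sqrt (1 - x ^ 2) : ℂ) :=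
      congrFun (congrFun h1 0) 1
    have e10 : U x Ψ 1 0 = Complex.I * ((Q.eval x : ℝ) : ℂ) * (Real.sqrt (1 - x ^ 2) : ℂ) :=
      congrFun (congrFun h1 1) 0
    have e11 : -Complex.I * U x Ψ 1 1 = (starRingEnd ℂ) (P.eval (x : ℂ)) :=
      congrFun (congrFun h1 1) 1
    have hs : (Real.sqrt (1 - x ^ 2) : ℂ) ≠ 0 := by
      rw [Complex.ofReal_ne_zero, Real.sqrt_ne_zero']
      nlinarith [hx.1, hx.2]
    have hPx := hP x hx'
    have hQx := hQ x hx
    rw [← conj_circlePoint, ← circlePoint] at hPx hQx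
    rw [eq_div_iff (by simp [hs])] at hQx
    have hsplit : P.eval (x : ℂ) = f.eval x + ((P.eval (x : ℂ)).im : ℂ) * Complex.I := by
      rw [← hadm.re_P x]; exact (Complex.re_add_im _).symm
    have hsplit' : (starRingEnd ℂ) (P.eval (x : ℂ)) =
        f.eval x - ((P.eval (x : ℂ)).im : ℂ) * Complex.I := by
      conv_lhs => rw [hsplit]
      simp [sub_eq_add_neg]
    rw [hsplit] at e00
    rw [hsplit'] at e11
    obtain ⟨m1, m2⟩ := U_mulVec_eq hx' Ψ
    rw [discPoly_eval_eq f hz]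
    set z := circlePoint x
    set s : ℂ := (Real.sqrt (1 - x ^ 2) : ℂ)
    have u00 : U x Ψ 0 0 = ((P.eval (x : ℂ)).im : ℂ) - Complex.I * f.eval x := by
      linear_combination -Complex.I * e00 + (U x Ψ 0 0 - ((P.eval (x : ℂ)).im : ℂ)) * Complex.I_sq
    have u11 : U x Ψ 1 1 = ((P.eval (x : ℂ)).im : ℂ) + Complex.I * f.eval x := by
      linear_combination Complex.I * e11 + (U x Ψ 1 1 - ((P.eval (x : ℂ)).im : ℂ)) * Complex.I_sq
    constructor
    · rw [e01, u00] at m1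
      rw [e10, u11] at m2
      linear_combination -(m1 + m2) / 2 + z ^ d * hPx + z ^ d * hQx / 2
    · refine mul_left_cancel₀ Complex.I_ne_zero ?_
      rw [e01, u00] at m1
      rw [e10, u11] at m2
      linear_combination -(m1 - m2) / 2
  have hinj := map_injective Complex.ofRealHom Complex.ofRealHom.injective
  refine Prod.ext (hinj ?_) (hinj ?_) <;> refine eq_of_eval_circlePoint_sq fun x hx => ?_
  · rw [(key x hx).1, Polynomial.map_mul, map_C, eval_mul, eval_C, eval_map_eq_discPoly hR]
    rfl
  · have hx' := Set.Ioo_subset_Icc_self hx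
    have hre : (circlePoint x).re = x := by simp [circlePoint]
    rw [(key x hx).2, Polynomial.map_neg, eval_neg, hF _ (circlePoint_ne_zero hx'),
      add_inv_div_two (norm_circlePoint hx'), hre, eval_map_ofReal]

/-! ### The admissible pair obtained from the roots inside the unit disc -/

theorem chebyshev_circlePoint {x : ℝ} (hx : x ∈ Set.Icc (-1 : ℝ) 1) (n : ℤ) :
    (((Chebyshev.T ℝ n).eval x : ℝ) : ℂ) =
        (circlePoint x ^ n + (starRingEnd ℂ) (circlePoint x) ^ n) / 2 ∧
      (((Chebyshev.U ℝ (n - 1)).eval x : ℝ) : ℂ) * (2 * Complex.I * (Real.sqrt (1 - x ^ 2) : ℂ)) =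
        circlePoint x ^ n - (starRingEnd ℂ) (circlePoint x) ^ n := by
  set θ := Real.arccos x with hθ
  have hx' : Real.cos θ = x := Real.cos_arccos hx.1 hx.2
  have hs : Real.sqrt (1 - x ^ 2) = Real.sin θ := (Real.sin_arccos x).symm
  have hpow : circlePoint x ^ n =
      (Real.cos (n * θ) : ℂ) + Complex.I * (Real.sin (n * θ) : ℂ) := by
    rw [← exp_I_mul, circlePoint, hs]
    nth_rw 1 [← hx']
    rw [← exp_I_mul, ← Complex.exp_int_mul]
    congr 1
    push_cast
    ring
  have hpow' : (starRingEnd ℂ) (circlePoint x) ^ n =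
      (Real.cos (n * θ) : ℂ) - Complex.I * (Real.sin (n * θ) : ℂ) := by
    rw [← map_zpow₀, hpow, map_add, map_mul, Complex.conj_ofReal, Complex.conj_ofReal,
      Complex.conj_I]
    ring
  have hT := Chebyshev.T_real_cos θ n
  have hU := Chebyshev.U_real_cos θ (n - 1)
  rw [hx'] at hT hU
  push_cast at hU
  rw [sub_add_cancel] at hU
  constructor
  · rw [hpow, hpow', hT]
    ring
  · rw [hpow, hpow', hs, ← hU]
    push_cast
    ring

theorem e_eq_sum {d : ℕ} {f p : ℝ[X]} (hp : p.map Complex.ofRealHom = discPoly d f)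
    (hpd : p.natDegree ≤ 2 * d) {z : ℂ} (hz : z ≠ 0) :
    e d f z = ∑ k ∈ Finset.range (2 * d + 1), (p.coeff k : ℂ) * z ^ ((k : ℤ) - d) := by
  rw [e_eq, ← hp, eval_eq_sum_range' (n := 2 * d + 1)
    (lt_of_le_of_lt natDegree_map_le (Nat.lt_succ_of_le hpd)), Finset.mul_sum]
  refine Finset.sum_congr rfl fun k _ => ?_
  rw [coeff_map, zpow_sub₀ hz, zpow_neg, zpow_natCast, zpow_natCast, Complex.ofRealHom_eq_coe]
  field_simp

theorem natDegree_chebyshevU_le {d : ℕ} {n : ℤ} (hn : n.natAbs ≤ d) :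
    (Chebyshev.U ℝ (n - 1)).natDegree ≤ d - 1 := by
  obtain ⟨m, rfl | rfl⟩ := n.eq_nat_or_neg
  · cases m with
    | zero => simp
    | succ m =>
      rw [show ((m + 1 : ℕ) : ℤ) - 1 = (m : ℤ) by push_cast; ring, Chebyshev.natDegree_U_natCast]
      omega
  · rw [Chebyshev.U_neg_sub_one, natDegree_neg]
    cases m with
    | zero => simp
    | succ m =>
      rw [show ((m + 1 : ℕ) : ℤ) - 1 = (m : ℤ) by push_cast; ring, Chebyshev.natDegree_U_natCast]
      omega

theorem coeff_chebyshevU_eq_zero {d : ℕ} {n : ℤ} (hn : n.natAbs < d) :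
    (Chebyshev.U ℝ (n - 1)).coeff (d - 1) = 0 := by
  -- For `d = 1` the degree bound is not strict at `n = 0`; there `U_{-1} = 0` is used.
  rcases eq_or_ne n 0 with rfl | h0
  · simp
  · refine coeff_eq_zero_of_natDegree_lt ?_
    have := natDegree_chebyshevU_le (d := n.natAbs) le_rfl
    have := Int.natAbs_pos.mpr h0
    omega

theorem coeff_chebyshevU_top {d : ℕ} (hd : 1 ≤ d) :
    (Chebyshev.U ℝ ((d : ℤ) - 1)).coeff (d - 1) = 2 ^ (d - 1) := by
  obtain ⟨m, rfl⟩ : ∃ m, d = m + 1 := ⟨d - 1, by omega⟩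
  rw [show ((m + 1 : ℕ) : ℤ) - 1 = (m : ℤ) by push_cast; ring, Nat.add_sub_cancel]
  have h := Chebyshev.leadingCoeff_U_natCast ℝ m
  rwa [leadingCoeff, Chebyshev.natDegree_U_natCast] at h

theorem norm_multiset_prod_lt_one {s : Multiset ℂ} (hs : s ≠ 0) (h : ∀ r ∈ s, ‖r‖ < 1) :
    ‖s.prod‖ < 1 := by
  induction s using Multiset.induction with
  | empty => exact absurd rfl hs
  | cons a s ih =>
    rw [Multiset.prod_cons, norm_mul]
    have ha := h a (Multiset.mem_cons_self a s)
    rcases eq_or_ne s 0 with rfl | hs'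
    · simpa using ha
    · have := ih hs' fun r hr => h r (Multiset.mem_cons_of_mem hr)
      exact mul_lt_one_of_nonneg_of_lt_one_left (norm_nonneg _) ha this.le

/-- Up to sign this is a nonempty product of numbers in the open disc. It makes the leading
coefficient of `Q` positive. -/
theorem norm_discPoly_coeff_zero_lt_one {d : ℕ} (hd : 1 ≤ d) {f : ℝ[X]} (hf : f.natDegree = d)
    (hlt : ∀ x ∈ Set.Icc (-1 : ℝ) 1, f.eval x ^ 2 < 1) : ‖(discPoly d f).coeff 0‖ < 1 := by
  have hdeg := natDegree_discPoly hd hf hlt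
  rw [coeff_zero_eq_eval_zero, discPoly, eval_multiset_prod_X_sub_C]
  refine norm_multiset_prod_lt_one (fun h => ?_) fun r hr => ?_
  · rw [Multiset.map_eq_zero] at h
    rw [discPoly, h] at hdeg
    simp at hdeg
    omega
  · obtain ⟨w, hw, rfl⟩ := Multiset.mem_map.mp hr
    simpa using (Multiset.mem_filter.mp hw).2

theorem e_neg {d : ℕ} (hd : 1 ≤ d) {f : ℝ[X]} (hf : f.natDegree = d)
    (hpar : f.comp (-X) = (-1) ^ d * f) (hlt : ∀ x ∈ Set.Icc (-1 : ℝ) 1, f.eval x ^ 2 < 1)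
    (z : ℂ) : e d f (-z) = (-1) ^ d * e d f z := by
  have h := congrArg (fun p => p.eval z) (discPoly_comp_neg hd hf hpar hlt)
  simp only [eval_comp, eval_neg, eval_X] at h
  have h1 : (-z) ^ (-(d : ℤ)) = (-1) ^ d * z ^ (-(d : ℤ)) := by
    rw [zpow_neg, zpow_neg, zpow_natCast, zpow_natCast, neg_pow, mul_inv, ← inv_pow]
    norm_num
  rw [e_eq, e_eq, h, h1]
  ring

/-- The real polynomials `G = Im P` and `Q` obtained from `e` by Chebyshev expansion. -/
theorem exists_complementary {d : ℕ} (hd : 1 ≤ d) {f : ℝ[X]} (hf : f.natDegree = d)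
    (hlt : ∀ x ∈ Set.Icc (-1 : ℝ) 1, f.eval x ^ 2 < 1) {β : ℝ} (hβ : 0 < β) :
    ∃ G Q : ℝ[X], G.natDegree ≤ d ∧ Q.natDegree = d - 1 ∧ 0 < Q.leadingCoeff ∧
      ∀ x ∈ Set.Icc (-1 : ℝ) 1,
        ((G.eval x : ℝ) : ℂ) = β * (e d f (circlePoint x) +
          e d f ((starRingEnd ℂ) (circlePoint x))) / 2 ∧
        ((Q.eval x : ℝ) : ℂ) * (2 * Complex.I * (Real.sqrt (1 - x ^ 2) : ℂ)) =
          β * (e d f (circlePoint x) - e d f ((starRingEnd ℂ) (circlePoint x))) := by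
  obtain ⟨p, hp⟩ := exists_map_ofReal_eq (map_conj_discPoly hd hf hlt)
  have hpd : p.natDegree = 2 * d := by
    rw [← natDegree_discPoly hd hf hlt, ← hp, natDegree_map]
  have hp1 : p.coeff (2 * d) = 1 := by
    have h := monic_discPoly d f
    rw [← hp, monic_map_iff] at h
    rw [← hpd]
    exact h
  have hp0 : p.coeff 0 < 1 := by
    have h := norm_discPoly_coeff_zero_lt_one hd hf hlt
    rw [← hp, coeff_map, Complex.ofRealHom_eq_coe, Complex.norm_real] at h
    exact (abs_lt.mp h).2
  set G : ℝ[X] := C β * ∑ k ∈ Finset.range (2 * d + 1),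
    C (p.coeff k) * Chebyshev.T ℝ ((k : ℤ) - d) with hG
  set Q : ℝ[X] := C β * ∑ k ∈ Finset.range (2 * d + 1),
    C (p.coeff k) * Chebyshev.U ℝ ((k : ℤ) - d - 1) with hQ
  have hQdeg : Q.natDegree ≤ d - 1 := by
    refine (natDegree_C_mul_le _ _).trans (natDegree_sum_le_of_forall_le _ _ fun k hk => ?_)
    have := Finset.mem_range.mp hk
    exact (natDegree_C_mul_le _ _).trans (natDegree_chebyshevU_le (by omega))
  have hQc : 0 < Q.coeff (d - 1) := by
    -- Only the two extreme indices reach degree `d - 1`, and they carry `U_{d-1}` and `U_{-d-1} =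
    -- -U_{d-1}`; hence the factor `1 - p.coeff 0`.
    have h1 : Q.coeff (d - 1) = β * ((1 - p.coeff 0) * 2 ^ (d - 1)) := by
      rw [hQ, coeff_C_mul, finsetSum_coeff, Finset.sum_eq_add (2 * d) 0 (by omega)]
      · rw [coeff_C_mul, coeff_C_mul, hp1,
          show (((2 * d : ℕ) : ℤ) - d - 1) = (d : ℤ) - 1 by push_cast; ring, coeff_chebyshevU_top hd,
          show (((0 : ℕ) : ℤ) - d - 1) = -(d : ℤ) - 1 by push_cast; ring, Chebyshev.U_neg_sub_one,
          coeff_neg, coeff_chebyshevU_top hd]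
        ring
      · intro k hk hk'
        have := Finset.mem_range.mp hk
        rw [coeff_C_mul, coeff_chebyshevU_eq_zero (by omega), mul_zero]
      · simp
      · simp
    rw [h1]
    exact mul_pos hβ (mul_pos (by linarith) (by positivity))
  have hQn : Q.natDegree = d - 1 := le_antisymm hQdeg (le_natDegree_of_ne_zero hQc.ne')
  refine ⟨G, Q, ?_, hQn, by rwa [leadingCoeff, hQn], fun x hx => ?_⟩
  · refine (natDegree_C_mul_le _ _).trans (natDegree_sum_le_of_forall_le _ _ fun k hk => ?_)
    have := Finset.mem_range.mp hk
    refine (natDegree_C_mul_le _ _).trans ?_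
    rw [Chebyshev.natDegree_T]
    omega
  · have hz := circlePoint_ne_zero hx
    have hz' : (starRingEnd ℂ) (circlePoint x) ≠ 0 := (_root_.map_ne_zero _).mpr hz
    rw [e_eq_sum hp hpd.le hz, e_eq_sum hp hpd.le hz']
    constructor
    · rw [hG, eval_mul, eval_C, eval_finsetSum, ← Finset.sum_add_distrib, Complex.ofReal_mul,
        Complex.ofReal_sum, mul_div_assoc, Finset.sum_div]
      congr 1
      refine Finset.sum_congr rfl fun k _ => ?_
      rw [eval_mul, eval_C, Complex.ofReal_mul, (chebyshev_circlePoint hx _).1]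
      ring
    · rw [hQ, eval_mul, eval_C, eval_finsetSum, ← Finset.sum_sub_distrib, Complex.ofReal_mul,
        Complex.ofReal_sum, mul_assoc, Finset.sum_mul]
      congr 1
      refine Finset.sum_congr rfl fun k _ => ?_
      rw [eval_mul, eval_C, Complex.ofReal_mul, mul_assoc, (chebyshev_circlePoint hx _).2]
      ring

theorem circlePoint_neg (x : ℝ) :
    circlePoint (-x) = -(starRingEnd ℂ) (circlePoint x) := by
  rw [conj_circlePoint, circlePoint]
  push_cast
  rw [neg_sq]
  ring

theorem comp_neg_of_eval_Ioo {p : ℝ[X]} {n : ℕ}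
    (h : ∀ x ∈ Set.Ioo (-1 : ℝ) 1, p.eval (-x) = (-1) ^ n * p.eval x) :
    p.comp (-X) = (-1) ^ n * p := by
  refine eq_of_eval_Ioo fun x hx => ?_
  rw [eval_comp, eval_neg, eval_X, h x hx]
  simp

/-- Take `P = f + iG`. The parities come from `x ↦ -x` acting as `z ↦ -z̄`, and the normalization is
the spectral factorization on the unit circle. -/
theorem exists_isMaximalPair {d : ℕ} (hd : 1 ≤ d) {f : ℝ[X]} (hf : f.natDegree = d)
    (hpar : f.comp (-X) = (-1) ^ d * f) (hlt : ∀ x ∈ Set.Icc (-1 : ℝ) 1, f.eval x ^ 2 < 1)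
    {α : ℝ} (hα : 0 < α) (hfac : ∀ z : ℂ, z ≠ 0 → laurentF f z = α * e d f z * e d f z⁻¹) :
    ∃ (P : ℂ[X]) (Q : ℝ[X]), IsMaximalPair d f P Q ∧ ∀ x ∈ Set.Icc (-1 : ℝ) 1,
      ((P.eval (x : ℂ)).im : ℂ) +
        Complex.I * ((Q.eval x : ℝ) : ℂ) * (Real.sqrt (1 - x ^ 2) : ℂ) =
        Real.sqrt α * e d f (circlePoint x) := by
  obtain ⟨G, Q, hGd, hQd, hQl, hGQ⟩ := exists_complementary hd hf hlt (Real.sqrt_pos.mpr hα)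
  set P : ℂ[X] := f.map Complex.ofRealHom + C Complex.I * G.map Complex.ofRealHom with hP
  have hPeval : ∀ x : ℝ, P.eval (x : ℂ) = f.eval x + Complex.I * G.eval x := by
    intro x
    rw [hP, eval_add, eval_mul, eval_C, eval_map_ofReal, eval_map_ofReal]
  have hre : ∀ x : ℝ, (P.eval (x : ℂ)).re = f.eval x := by
    intro x; simp [hPeval]
  have him : ∀ x : ℝ, (P.eval (x : ℂ)).im = G.eval x := by
    intro x; simp [hPeval]
  have hG : G.comp (-X) = (-1) ^ d * G := by
    refine comp_neg_of_eval_Ioo fun x hx => ?_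
    have hx' := Set.Ioo_subset_Icc_self hx
    have h1 := (hGQ x hx').1
    have h2 := (hGQ (-x) ⟨by linarith [hx.2], by linarith [hx.1]⟩).1
    rw [circlePoint_neg, map_neg, Complex.conj_conj, e_neg hd hf hpar hlt,
      e_neg hd hf hpar hlt] at h2
    have : ((G.eval (-x) : ℝ) : ℂ) = (-1) ^ d * ((G.eval x : ℝ) : ℂ) := by
      rw [h2, h1]; ring
    exact_mod_cast this
  have hQ : Q.comp (-X) = (-1) ^ (d - 1) * Q := by
    refine comp_neg_of_eval_Ioo fun x hx => ?_
    have hx' := Set.Ioo_subset_Icc_self hx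
    have h1 := (hGQ x hx').2
    have h2 := (hGQ (-x) ⟨by linarith [hx.2], by linarith [hx.1]⟩).2
    rw [circlePoint_neg, map_neg, Complex.conj_conj, e_neg hd hf hpar hlt,
      e_neg hd hf hpar hlt, neg_sq] at h2
    have hs : (2 * Complex.I * (Real.sqrt (1 - x ^ 2) : ℂ)) ≠ 0 := by
      have : Real.sqrt (1 - x ^ 2) ≠ 0 := by
        rw [Real.sqrt_ne_zero']
        nlinarith [hx.1, hx.2]
      simp [this]
    have hsign : ((-1 : ℂ)) ^ d = -(-1) ^ (d - 1) := by
      obtain ⟨m, rfl⟩ : ∃ m, d = m + 1 := ⟨d - 1, by omega⟩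
      rw [Nat.add_sub_cancel, pow_succ]; ring
    have : ((Q.eval (-x) : ℝ) : ℂ) = (-1) ^ (d - 1) * ((Q.eval x : ℝ) : ℂ) := by
      refine mul_right_cancel₀ hs ?_
      rw [h2, mul_assoc, h1, hsign]
      ring
    exact_mod_cast this
  have hsum : ∀ x ∈ Set.Icc (-1 : ℝ) 1, ((P.eval (x : ℂ)).im : ℂ) +
      Complex.I * ((Q.eval x : ℝ) : ℂ) * (Real.sqrt (1 - x ^ 2) : ℂ) =
        Real.sqrt α * e d f (circlePoint x) := by
    intro x hx
    obtain ⟨h1, h2⟩ := hGQ x hx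
    rw [him]
    linear_combination h1 + h2 / 2
  refine ⟨P, Q, ⟨⟨?_, hQd, ?_, hQ, ?_, hQl, hre⟩, α, hα, hfac, ?_, ?_⟩, hsum⟩
  · refine le_antisymm ?_ (le_natDegree_of_ne_zero fun h0 => ?_)
    · exact natDegree_add_le_of_degree_le (natDegree_map_le.trans hf.le)
        ((natDegree_C_mul_le _ _).trans (natDegree_map_le.trans hGd))
    -- The real part of the top coefficient is that of `f`, so `G` cannot cancel it.
    · have h1 := congrArg Complex.re h0
      simp [hP] at h1
      have : f.leadingCoeff = 0 := by rw [leadingCoeff, hf, h1]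
      rw [leadingCoeff_eq_zero] at this
      rw [this] at hf
      simp at hf
      omega
  · have h1 := congrArg (Polynomial.map Complex.ofRealHom) hpar
    have h2 := congrArg (Polynomial.map Complex.ofRealHom) hG
    simp only [Polynomial.map_comp, Polynomial.map_mul, Polynomial.map_neg, map_X,
      Polynomial.map_pow, Polynomial.map_one] at h1 h2
    rw [hP, add_comp, mul_comp, C_comp, h1, h2]
    ring
  · intro x hx
    obtain ⟨h1, h2⟩ := hGQ x hx
    have h3 := hfac _ (circlePoint_ne_zero hx)
    have hxre : (circlePoint x).re = x := by simp [circlePoint]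
    rw [laurentF_of_norm_eq_one f (norm_circlePoint hx), inv_circlePoint hx, hxre] at h3
    have hα' : (Real.sqrt α : ℂ) ^ 2 = α := by exact_mod_cast Real.sq_sqrt hα.le
    rw [← Complex.normSq_eq_norm_sq, Complex.normSq_apply, hre, him]
    have hs := sq_add_sq_sqrt hx
    have : ((f.eval x : ℝ) : ℂ) * f.eval x +
        ((G.eval x : ℝ) : ℂ) * G.eval x +
        (1 - (x : ℂ) ^ 2) * ((Q.eval x : ℝ) : ℂ) ^ 2 = 1 := by
      push_cast at h3
      set z := circlePoint x
      set s : ℂ := (Real.sqrt (1 - x ^ 2) : ℂ)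
      have h4 : ((G.eval x : ℝ) : ℂ) + Complex.I * s * ((Q.eval x : ℝ) : ℂ) = Real.sqrt α * e d f z := by
        linear_combination h1 + h2 / 2
      have h5 : ((G.eval x : ℝ) : ℂ) - Complex.I * s * ((Q.eval x : ℝ) : ℂ) =
          Real.sqrt α * e d f ((starRingEnd ℂ) z) := by
        linear_combination h1 - h2 / 2
      have h6 : (((G.eval x : ℝ) : ℂ) + Complex.I * s * ((Q.eval x : ℝ) : ℂ)) *
          (((G.eval x : ℝ) : ℂ) - Complex.I * s * ((Q.eval x : ℝ) : ℂ)) =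
          α * e d f z * e d f ((starRingEnd ℂ) z) := by
        rw [h4, h5, ← hα']; ring
      linear_combination h6 - h3 + s ^ 2 * ((Q.eval x : ℝ) : ℂ) ^ 2 * Complex.I_sq -
        ((Q.eval x : ℝ) : ℂ) ^ 2 * hs
    exact_mod_cast this
  · intro x hx
    rw [← conj_circlePoint, ← circlePoint, him]
    exact (hGQ x hx).1
  · intro x hx
    have hs : (Real.sqrt (1 - x ^ 2) : ℂ) ≠ 0 := by
      rw [Complex.ofReal_ne_zero, Real.sqrt_ne_zero']
      nlinarith [hx.1, hx.2]
    rw [← conj_circlePoint, ← circlePoint, eq_div_iff (by simp [hs])]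
    exact (hGQ x (Set.Ioo_subset_Icc_self hx)).2

/-! ### Phase factors in the open box -/

theorem le_sq_cos_of_prod {d : ℕ} {Ψ : Fin (d + 1) → ℝ} {α : ℝ} (hα : 0 ≤ α)
    (hprod : ∏ j, Real.cos (Ψ j) = Real.sqrt α) (j : Fin (d + 1)) : α ≤ Real.cos (Ψ j) ^ 2 := by
  rw [← Real.sq_sqrt hα, ← hprod, ← Finset.prod_pow]
  rw [← Finset.mul_prod_erase _ _ (Finset.mem_univ j)]
  exact mul_le_of_le_one_right (sq_nonneg _)
    (Finset.prod_le_one (fun _ _ => sq_nonneg _) fun i _ => Real.cos_sq_le_one (Ψ i))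

theorem sq_cos_le_half {ψ : ℝ} (h1 : Real.pi / 4 ≤ ψ) (h2 : ψ ≤ 3 * Real.pi / 4) :
    Real.cos ψ ^ 2 ≤ 1 / 2 := by
  have := Real.cos_nonpos_of_pi_div_two_le_of_le (x := 2 * ψ) (by linarith) (by linarith)
  rw [Real.cos_two_mul] at this
  linarith

theorem two_mul_ne_of_mem_ends {d : ℕ} (hd : 1 ≤ d) {j : Fin (d + 1)}
    (hj : j = 0 ∨ j = Fin.last d) : 2 * (j : ℕ) ≠ d := by
  rcases hj with rfl | rfl <;> simp <;> omega

/-- After the shift the end phases lie in `[-3π/4, π/4)`, and `cos² > 1/2` excludes the part below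
`-π/2`. For the middle phase in `[-π, π)` the square is not enough: its cosine is positive because
the whole product and all other cosines are. -/
theorem mem_openBox_of_prod {d : ℕ} (hd : 1 ≤ d) {Ψ : Fin (d + 1) → ℝ} {α : ℝ} (hα : 1 / 2 < α)
    (hdom : Ψ + initialPhase d ∈ phaseDomain d)
    (hprod : ∏ j, Real.cos (Ψ j) = Real.sqrt α) : Ψ ∈ openBox d := by
  have hcos : ∀ j, 1 / 2 < Real.cos (Ψ j) ^ 2 := fun j =>
    hα.trans_le (le_sq_cos_of_prod (by linarith) hprod j)
  have hpi := Real.pi_pos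
  have houter : ∀ j : Fin (d + 1), 2 * (j : ℕ) ≠ d →
      Ψ j ∈ Set.Ioo (-(Real.pi / 2)) (Real.pi / 2) := by
    intro j hj
    have h := hdom j
    rw [if_neg hj, Pi.add_apply, initialPhase] at h
    split_ifs at h with hends
    · refine ⟨?_, by linarith [h.2]⟩
      by_contra hle
      have := sq_cos_le_half (ψ := -Ψ j) (by linarith) (by linarith [h.1])
      rw [Real.cos_neg] at this
      exact absurd (hcos j) this.not_gt
    · rw [add_zero] at h
      refine ⟨lt_of_le_of_ne h.1 fun heq => ?_, h.2⟩
      have := hcos j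
      rw [← heq, Real.cos_neg, Real.cos_pi_div_two] at this
      norm_num at this
  intro j
  by_cases hj : 2 * (j : ℕ) = d
  · have hpos : 0 < Real.cos (Ψ j) := by
      have h1 : 0 < ∏ j, Real.cos (Ψ j) := hprod ▸ Real.sqrt_pos.mpr (by linarith)
      rw [← Finset.mul_prod_erase _ _ (Finset.mem_univ j)] at h1
      refine pos_of_mul_pos_left h1 (Finset.prod_nonneg fun i hi => ?_)
      have hij : 2 * (i : ℕ) ≠ d := fun h =>
        (Finset.mem_erase.mp hi).1 (Fin.ext (by omega))
      exact (Real.cos_pos_of_mem_Ioo (houter i hij)).le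
    have h := hdom j
    have hends : ¬ (j = 0 ∨ j = Fin.last d) := fun h => two_mul_ne_of_mem_ends hd h hj
    rw [if_pos hj, Pi.add_apply, initialPhase, if_neg hends, add_zero] at h
    constructor
    · by_contra hle
      have := Real.cos_nonpos_of_pi_div_two_le_of_le (x := -Ψ j) (by linarith) (by linarith [h.1])
      rw [Real.cos_neg] at this
      linarith
    · by_contra hle
      have := Real.cos_nonpos_of_pi_div_two_le_of_le (x := Ψ j) (by linarith) (by linarith [h.2])
      linarith
  · exact houter j hj

theorem add_initialPhase_mem_phaseDomain {d : ℕ} (hd : 1 ≤ d) {Ψ : Fin (d + 1) → ℝ}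
    (hΨ : Ψ ∈ openBox d) (hcos : ∀ j, 1 / 2 < Real.cos (Ψ j) ^ 2) :
    Ψ + initialPhase d ∈ phaseDomain d := by
  intro j
  have hpi := Real.pi_pos
  have h := hΨ j
  rw [Pi.add_apply, initialPhase]
  by_cases hends : j = 0 ∨ j = Fin.last d
  · rw [if_neg (two_mul_ne_of_mem_ends hd hends), if_pos hends]
    refine ⟨by linarith [h.1], ?_⟩
    -- An end phase has to stay below `π/4`, and this is where the threshold `1/2` for `cos²` is
    -- needed.
    by_contra hle
    exact absurd (hcos j) (sq_cos_le_half (by linarith) (by linarith [h.2])).not_gt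
  · rw [if_neg hends, add_zero]
    split_ifs
    · exact ⟨by linarith [h.1], by linarith [h.2]⟩
    · exact ⟨h.1.le, h.2⟩

/-! ### The Euclidean bound from the product of cosines -/

theorem one_add_sum_le_prod_one_add {ι : Type*} (s : Finset ι) (g : ι → ℝ) (hg : ∀ i, 0 ≤ g i) :
    1 + ∑ i ∈ s, g i ≤ ∏ i ∈ s, (1 + g i) := by
  classical
  induction s using Finset.induction_on with
  | empty => simp
  | insert a s ha ih =>
    rw [Finset.sum_insert ha, Finset.prod_insert ha]
    have := Finset.sum_nonneg fun i (_ : i ∈ s) => hg i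
    nlinarith [hg a, mul_nonneg (hg a) this, mul_le_mul_of_nonneg_left ih (hg a)]

/-- Multiply `1 + ψ² ≤ 1 + tan² ψ = 1/cos² ψ` over all phases and keep only the linear terms of the
product on the left. -/
theorem sum_sq_le_of_prod {d : ℕ} {Ψ : Fin (d + 1) → ℝ} {α : ℝ} (hα : 0 < α)
    (hΨ : Ψ ∈ openBox d) (hprod : ∏ j, Real.cos (Ψ j) = Real.sqrt α) :
    ∑ j, Ψ j ^ 2 ≤ α⁻¹ - 1 := by
  have hpi := Real.pi_pos
  have hcos : ∀ j, 1 + Ψ j ^ 2 ≤ (Real.cos (Ψ j) ^ 2)⁻¹ := by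
    intro j
    have h0 := Real.cos_pos_of_mem_Ioo (hΨ j)
    have h1 := Real.cos_le_one_div_sqrt_sq_add_one (x := Ψ j) (by linarith [(hΨ j).1])
      (by linarith [(hΨ j).2])
    have h2 := pow_le_pow_left₀ h0.le h1 2
    rw [div_pow, one_pow, Real.sq_sqrt (by positivity), one_div] at h2
    rw [le_inv_comm₀ (by positivity) (pow_pos h0 2), add_comm]
    exact h2
  have h1 := one_add_sum_le_prod_one_add Finset.univ (fun j => Ψ j ^ 2) fun j => sq_nonneg _
  have h2 : ∏ j, (1 + Ψ j ^ 2) ≤ ∏ j, (Real.cos (Ψ j) ^ 2)⁻¹ :=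
    Finset.prod_le_prod (fun j _ => by positivity) fun j _ => hcos j
  rw [Finset.prod_inv_distrib, Finset.prod_pow, hprod, Real.sq_sqrt hα.le] at h2
  linarith

/-- The reduced vector keeps a subset of the coordinates; the doubling due to symmetry is not
exploited. -/
theorem norm_sq_reduced_sub_le {d : ℕ} (Ψ : Fin (d + 1) → ℝ) :
    ‖reduced (Ψ + initialPhase d) - reduced (initialPhase d)‖ ^ 2 ≤ ∑ j, Ψ j ^ 2 := by
  rw [EuclideanSpace.real_norm_sq_eq]
  have h : ∀ j, (reduced (Ψ + initialPhase d) - reduced (initialPhase d)) j =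
      Ψ (Fin.castLE (reducedLength_le d) j) := fun j => by simp [reduced]
  simp only [h]
  exact (Finset.sum_map Finset.univ (Fin.castLEEmb (reducedLength_le d))
    fun j => Ψ j ^ 2).symm.trans_le (Finset.sum_le_univ_sum_of_nonneg fun j => sq_nonneg _)

/-! ### From column pairs to the maximal solution -/

theorem abs_eval_le_maxNorm (f : ℝ[X]) {x : ℝ} (hx : x ∈ Set.Icc (-1 : ℝ) 1) :
    |f.eval x| ≤ maxNorm f :=
  le_csSup (isCompact_Icc.image (f.continuous.abs)).bddAbove ⟨x, hx, rfl⟩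

/-- The pair gives `U(x, Ψ)(1, 1)ᵀ`, and the `SU(2)` shape gives the remaining entries. The
resulting matrix is symmetric, so `Ψ` and its reversal generate the same matrices and coincide by
uniqueness in the box. -/
theorem isMaximalSolution_of_columnPair {d : ℕ} (hd : 1 ≤ d) {f R F : ℝ[X]}
    (hf : f.natDegree = d) (hpar : f.comp (-X) = (-1) ^ d * f)
    (hlt : ∀ x ∈ Set.Icc (-1 : ℝ) 1, f.eval x ^ 2 < 1) {α : ℝ} (hα : 0 < α)
    (hfac : ∀ z : ℂ, z ≠ 0 → laurentF f z = α * e d f z * e d f z⁻¹)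
    (hR : (expand ℝ 2 R).map Complex.ofRealHom = discPoly d f)
    (hF : ∀ z : ℂ, z ≠ 0 → (F.map Complex.ofRealHom).eval (z ^ 2) =
      z ^ d * (f.map Complex.ofRealHom).eval ((z + z⁻¹) / 2))
    {Ψ : Fin (d + 1) → ℝ} (hΨ : Ψ ∈ openBox d) (hcol : columnPair Ψ = (C (Real.sqrt α) * R, -F))
    (hcos : ∀ j, 1 / 2 < Real.cos (Ψ j) ^ 2) :
    IsMaximalSolution d f (Ψ + initialPhase d) := by
  obtain ⟨P, Q, hPQ, hsum⟩ := exists_isMaximalPair hd hf hpar hlt hα hfac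
  have hUΨ : ∀ x ∈ Set.Icc (-1 : ℝ) 1, U x Ψ 0 0 = -Complex.I * P.eval (x : ℂ) ∧
      U x Ψ 0 1 = Complex.I * ((Q.eval x : ℝ) : ℂ) * (Real.sqrt (1 - x ^ 2) : ℂ) ∧
      U x Ψ 1 0 = U x Ψ 0 1 ∧
      U x Ψ 1 1 = Complex.I * (starRingEnd ℂ) (P.eval (x : ℂ)) := by
    intro x hx
    have hz := circlePoint_ne_zero hx
    obtain ⟨m1, m2⟩ := U_mulVec_eq hx Ψ
    obtain ⟨u10, u11⟩ := U_form x Ψ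
    have hre : (circlePoint x).re = x := by simp [circlePoint]
    rw [hcol] at m1 m2
    simp only [Polynomial.map_mul, Polynomial.map_neg, map_C, eval_mul, eval_neg, eval_C,
      Complex.ofRealHom_eq_coe] at m1 m2
    rw [eval_map_eq_discPoly hR, discPoly_eval_eq f hz, hF _ hz,
      add_inv_div_two (norm_circlePoint hx), hre, eval_map_ofReal] at m1 m2
    have hs := hsum x hx
    have hPre := hPQ.admissible.re_P x
    have hsplit : P.eval (x : ℂ) = f.eval x + ((P.eval (x : ℂ)).im : ℂ) * Complex.I := by
      rw [← hPre]; exact (Complex.re_add_im _).symm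
    set p := P.eval (x : ℂ)
    have v0 : U x Ψ 0 0 + U x Ψ 0 1 = (p.im : ℂ) +
        Complex.I * ((Q.eval x : ℝ) : ℂ) * (Real.sqrt (1 - x ^ 2) : ℂ) -
        Complex.I * f.eval x := by
      refine mul_left_cancel₀ (pow_ne_zero d hz) ?_
      linear_combination m1 - circlePoint x ^ d * hs
    have v1 : U x Ψ 1 0 + U x Ψ 1 1 = (p.im : ℂ) +
        Complex.I * ((Q.eval x : ℝ) : ℂ) * (Real.sqrt (1 - x ^ 2) : ℂ) +
        Complex.I * f.eval x := by
      refine mul_left_cancel₀ (pow_ne_zero d hz) ?_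
      linear_combination m2 - circlePoint x ^ d * hs
    -- Conjugating turns the second entry into `U₀₀ - U₀₁`, to be combined with `U₀₀ + U₀₁`.
    have v1' := congrArg (starRingEnd ℂ) v1
    simp only [u10, u11, map_add, map_neg, map_mul, Complex.conj_conj, Complex.conj_ofReal,
      Complex.conj_I] at v1'
    have e00 : U x Ψ 0 0 = -Complex.I * p := by
      rw [hsplit]
      linear_combination (v0 + v1') / 2 + (p.im : ℂ) * Complex.I_sq
    have e01 : U x Ψ 0 1 =
        Complex.I * ((Q.eval x : ℝ) : ℂ) * (Real.sqrt (1 - x ^ 2) : ℂ) := by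
      linear_combination (v0 - v1') / 2
    refine ⟨e00, e01, ?_, ?_⟩
    · rw [u10, e01]; simp
    · rw [u11, e00]; simp
  have hsymm : IsSymmetric Ψ := by
    have h : (fun j => Ψ j.rev) = Ψ := by
      refine eq_of_U_eq (fun j => hΨ j.rev) hΨ fun x hx => ?_
      rw [U_comp_rev]
      ext i j
      fin_cases i <;> fin_cases j <;> simp [(hUΨ x hx).2.2.1]
    exact congrFun h
  refine ⟨fun j => ?_, add_initialPhase_mem_phaseDomain hd hΨ hcos, P, Q, hPQ, fun x hx => ?_⟩
  · have : initialPhase d j.rev = initialPhase d j := by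
      simp only [initialPhase, Fin.rev_eq_iff, Fin.rev_zero, Fin.rev_last]
      exact if_congr or_comm rfl rfl
    rw [Pi.add_apply, Pi.add_apply, hsymm j, this]
  · obtain ⟨h1, h2, h3, h4⟩ := hUΨ x hx
    rw [U_add_initialPhase_eq hd, matrixPQ, h3, h1, h2, h4]
    have hI : ∀ w : ℂ, Complex.I * (-Complex.I * w) = w := fun w => by
      linear_combination -w * Complex.I_sq
    have hI' : ∀ w : ℂ, -Complex.I * (Complex.I * w) = w := fun w => by
      linear_combination -w * Complex.I_sq
    rw [hI, hI']

end SymmetricQSP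

end

theorem theorem3 (d : ℕ) (hd : 1 ≤ d) (f : Polynomial ℝ) (hdeg : f.natDegree = d)
    (hparity : f.comp (-Polynomial.X) = (-1) ^ d * f)
    (hnorm : SymmetricQSP.maxNorm f ≤ 1 / 2) :
    (∃! Φ : Fin (d + 1) → ℝ, SymmetricQSP.IsMaximalSolution d f Φ) ∧
      ∀ Φ : Fin (d + 1) → ℝ, SymmetricQSP.IsMaximalSolution d f Φ →
        ‖SymmetricQSP.reduced Φ - SymmetricQSP.reduced (SymmetricQSP.initialPhase d)‖ ≤
          Real.pi / Real.sqrt 3 * SymmetricQSP.maxNorm f := by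
  open SymmetricQSP in
  set M := maxNorm f with hM
  have hM0 : 0 ≤ M := (abs_nonneg _).trans (abs_eval_le_maxNorm f (x := 0) (by norm_num))
  have hle : ∀ x ∈ Set.Icc (-1 : ℝ) 1, 1 - M ^ 2 ≤ 1 - f.eval x ^ 2 := fun x hx => by
    have := pow_le_pow_left₀ (abs_nonneg _) (abs_eval_le_maxNorm f hx) 2
    rw [sq_abs] at this
    linarith
  -- The only use of `‖f‖ ≤ 1/2`; it puts `α` above the threshold `1/2` for the box.
  have hm : 3 / 4 ≤ 1 - M ^ 2 := by nlinarith
  have hlt : ∀ x ∈ Set.Icc (-1 : ℝ) 1, f.eval x ^ 2 < 1 := fun x hx => by linarith [hle x hx]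
  obtain ⟨R, hR, hRd, hRm⟩ := exists_real_discPoly hd hdeg hparity hlt
  obtain ⟨F, hFd, hF⟩ := exists_halved_laurent hdeg.le hparity
  obtain ⟨α, hα, hfac⟩ := exists_laurentF_eq hd hdeg hlt
  have hαm : 1 - M ^ 2 ≤ α := le_of_laurentF_eq hd hdeg (by linarith) hle hα hfac
  have hRc : R.coeff d = 1 := hRd ▸ hRm.coeff_natDegree
  have hcoeff : ∀ Ψ : Fin (d + 1) → ℝ,
      columnPair Ψ = (Polynomial.C (Real.sqrt α) * R, -F) →
        ∏ j, Real.cos (Ψ j) = Real.sqrt α := fun Ψ hΨ => by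
    rw [← coeff_columnPair_fst, hΨ, Polynomial.coeff_C_mul, hRc, mul_one]
  have hchar : ∀ Ψ : Fin (d + 1) → ℝ, IsMaximalSolution d f (Ψ + initialPhase d) →
      Ψ ∈ openBox d ∧ columnPair Ψ = (Polynomial.C (Real.sqrt α) * R, -F) := by
    intro Ψ hΨ
    obtain ⟨α', -, hfac', hcol⟩ := hΨ.columnPair_eq hd hR hF
    -- The factorization constant is unique, since `e` does not vanish at `1`.
    have hαα : α' = α := by
      have h := (hfac' 1 one_ne_zero).symm.trans (hfac 1 one_ne_zero)
      rw [mul_assoc, mul_assoc, e_mul_e_inv_of_norm_eq_one hd hdeg hlt norm_one] at h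
      refine Complex.ofReal_injective (mul_right_cancel₀ ?_ h)
      rw [Complex.ofReal_ne_zero]
      exact pow_ne_zero 2 (norm_ne_zero_iff.mpr (discPoly_eval_ne_zero norm_one))
    rw [hαα] at hcol
    exact ⟨mem_openBox_of_prod hd (by linarith) hΨ.2.1 (hcoeff Ψ hcol), hcol⟩
  refine ⟨?_, fun Φ hΦ => ?_⟩
  · obtain ⟨Ψ, hΨ, hcol⟩ := exists_columnPair_eq (d := d) (Polynomial.C (Real.sqrt α) * R) (-F)
      ((Polynomial.natDegree_C_mul_le _ _).trans hRd.le)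
      ((Polynomial.natDegree_neg F).trans_le hFd)
      (mul_reflect_add_mul_reflect hα hfac hR hRd.le hFd hF)
      (by rw [Polynomial.coeff_C_mul, hRc, mul_one]; exact Real.sqrt_pos.mpr hα)
    refine ⟨Ψ + initialPhase d, isMaximalSolution_of_columnPair hd hdeg hparity hlt hα hfac hR hF hΨ
      hcol fun j => ?_, fun Φ hΦ => ?_⟩
    · have := le_sq_cos_of_prod hα.le (hcoeff Ψ hcol) j
      linarith
    · obtain ⟨h1, h2⟩ := hchar (Φ - initialPhase d) (by rwa [sub_add_cancel])
      rw [← columnPair_injOn h1 hΨ (h2.trans hcol.symm), sub_add_cancel]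
  · obtain ⟨h1, h2⟩ := hchar (Φ - initialPhase d) (by rwa [sub_add_cancel])
    have h3 := (norm_sq_reduced_sub_le (Φ - initialPhase d)).trans
      (sum_sq_le_of_prod hα h1 (hcoeff _ h2))
    rw [sub_add_cancel] at h3
    -- From `1/α - 1 ≤ M²/(1 - M²)` and `1 - M² ≥ 3/4`.
    have h4 : α⁻¹ - 1 ≤ 4 / 3 * M ^ 2 := by
      have h5 : α⁻¹ ≤ (1 - M ^ 2)⁻¹ := inv_anti₀ (by linarith) hαm
      have h6 : (1 - M ^ 2)⁻¹ ≤ 1 + 4 / 3 * M ^ 2 := by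
        rw [inv_le_iff_one_le_mul₀ (by linarith)]
        nlinarith [sq_nonneg M]
      linarith
    refine abs_le_of_sq_le_sq' ?_ (by positivity) |>.2
    have h7 : (Real.pi / Real.sqrt 3 * M) ^ 2 = Real.pi ^ 2 / 3 * M ^ 2 := by
      rw [mul_pow, div_pow, Real.sq_sqrt (by norm_num)]
    rw [h7]
    -- There is slack here: the argument yields `2/√3`, and only `π ≥ 2` is needed to reach `π/√3`.
    nlinarith [Real.pi_gt_three, sq_nonneg M, mul_le_mul_of_nonneg_right
      (show (4 : ℝ) / 3 ≤ Real.pi ^ 2 / 3 by nlinarith [Real.pi_gt_three]) (sq_nonneg M)]
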